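/- Let $\Gamma$ be a metrized graph, i.e. a finite connected graph (a single vertex is allowed) in which every edge $e_i$ has a length $L_i>0$ and is parametrized by arc length by $[0,L_i]$. Let $V(\Gamma)$ be an optimal vertex set of $\Gamma$, i.e. a finite non-empty vertex set for which there are no self-loops and no two edges with the same pair of end points, and let $E(\Gamma)$ be the corresponding set of edges; let $p_i,q_i\in V(\Gamma)$ be the end points of $e_i$. The valence $\upsilon(p)$ of $p\in\Gamma$ is the number of directions emanating from $p$. Let $\mathrm L=(l_{pq})_{p,q\in V(\Gamma)}$ be the discrete Laplacian matrix: for $p\ne q$, $l_{pq}=-1/L_k$ if $p$ and $q$ are joined by an edge of length $L_k$ and $l_{pq}=0$ otherwise, and $l_{pp}=-\sum_{s\neq p}l_{ps}$. Let $\mathrm L^+=(l^+_{pq})$ be its Moore--Penrose pseudo inverse. For a continuous function $f$ on $\Gamma$ that is $C^2$ outside some finite vertex set $S$ (possibly larger than $V(\Gamma)$), with $f''\in L^1(\Gamma)$, put $\Delta f=-f''(x)\,dx-\sum_{p\in S}\big(\sum_{\vec v\text{ at }p}d_{\vec v}f(p)\big)\delta_p$. For $y,z\in\Gamma$ let the voltage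 function $x\mapsto j_z(x,y)$ be the unique such function with $\Delta_x j_z(x,y)=\delta_y-\delta_z$ and $j_z(z,y)=0$. For a real-valued signed Borel measure $\mu$ on $\Gamma$ put $j_\mu(x,y)=\int_\Gamma j_\zeta(x,y)\,d\mu(\zeta)$. The canonical measure $\mu_{can}$ of $\Gamma$ is the unique real-valued signed Borel measure $\mu$ on $\Gamma$ such that $\mu(\Gamma)=1$ and $j_\mu(x,x)$ is constant on $\Gamma$. Then the canonical measure exists, is unique, and is given by $$\mu_{can}=\sum_{p\in V(\Gamma)}\Big(1-\tfrac12\upsilon(p)\Big)\delta_p-\sum_{e_i\in E(\Gamma)}\Big(l_{p_iq_i}+l_{p_iq_i}^2\big(l^+_{p_ip_i}-2l^+_{p_iq_i}+l^+_{q_iq_i}\big)\Big)\,dx,$$ where $\delta_p$ is the Dirac measure at $p$ and, in the summand of $e_i$, $dx$ is the arc length measure on $e_i$. -/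

import Mathlib

open MeasureTheory Set
open scoped Matrix

noncomputable section

/-! ### The Moore-Penrose inverse of a real square matrix -/

section PseudoInverse

variable {n : Type*} [Fintype n]

/-- `P` is a pseudo inverse (Moore-Penrose generalized inverse) of the real matrix `A`. -/
structure IsPseudoInverse (A P : Matrix n n ℝ) : Prop where
  mul_mul_left : A * P * A = A
  mul_mul_right : P * A * P = P
  transpose_left : (A * P)ᵀ = A * P
  transpose_right : (P * A)ᵀ = P * A

/-- A matrix has at most one pseudo inverse. -/
theorem IsPseudoInverse.unique {A P Q : Matrix n n ℝ}
    (hP : IsPseudoInverse A P) (hQ : IsPseudoInverse A Q) : P = Q := by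
  have h1 : A * P = A * Q := by
    calc A * P = (A * Q * A) * P := by rw [hQ.mul_mul_left]
      _ = (A * Q) * (A * P) := by simp only [Matrix.mul_assoc]
      _ = (A * Q)ᵀ * (A * P)ᵀ := by rw [hQ.transpose_left, hP.transpose_left]
      _ = ((A * P * A) * Q)ᵀ := by
        rw [← Matrix.transpose_mul]; simp only [Matrix.mul_assoc]
      _ = A * Q := by rw [hP.mul_mul_left, hQ.transpose_left]
  have h2 : P * A = Q * A := by
    calc P * A = P * (A * Q * A) := by rw [hQ.mul_mul_left]
      _ = (P * A) * (Q * A) := by simp only [Matrix.mul_assoc]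
      _ = (P * A)ᵀ * (Q * A)ᵀ := by rw [hP.transpose_right, hQ.transpose_right]
      _ = (Q * (A * P * A))ᵀ := by
        rw [← Matrix.transpose_mul]; simp only [Matrix.mul_assoc]
      _ = Q * A := by rw [hP.mul_mul_left, hQ.transpose_right]
  calc P = P * A * P := hP.mul_mul_right.symm
    _ = Q * A * P := by rw [h2]
    _ = Q * (A * P) := Matrix.mul_assoc _ _ _
    _ = Q * A * Q := by rw [h1, Matrix.mul_assoc]
    _ = Q := hQ.mul_mul_right

/-- A real symmetric matrix has a pseudo inverse. -/
theorem exists_isPseudoInverse [DecidableEq n] {A : Matrix n n ℝ} (hA : A.IsSymm) :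
    ∃ P, IsPseudoInverse A P := by
  have hH : A.IsHermitian := by
    rw [Matrix.IsHermitian, Matrix.conjTranspose_eq_transpose_of_trivial]; exact hA
  obtain ⟨U, D, hU, hAU⟩ : ∃ (U : Matrix n n ℝ) (D : n → ℝ), Uᵀ * U = 1 ∧
      A = U * Matrix.diagonal D * Uᵀ := by
    refine ⟨hH.eigenvectorUnitary, hH.eigenvalues, ?_, ?_⟩
    · have := (Matrix.mem_unitaryGroup_iff').1 hH.eigenvectorUnitary.2
      rwa [Matrix.star_eq_conjTranspose, Matrix.conjTranspose_eq_transpose_of_trivial] at this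
    · have h := hH.spectral_theorem
      rw [Unitary.conjStarAlgAut_apply] at h
      simpa [Matrix.star_eq_conjTranspose, Matrix.conjTranspose_eq_transpose_of_trivial,
        Function.comp_def] using h
  have key : ∀ F G : n → ℝ, (U * Matrix.diagonal F * Uᵀ) * (U * Matrix.diagonal G * Uᵀ)
      = U * Matrix.diagonal (fun i => F i * G i) * Uᵀ := by
    intro F G
    calc (U * Matrix.diagonal F * Uᵀ) * (U * Matrix.diagonal G * Uᵀ)
        = U * Matrix.diagonal F * (Uᵀ * U) * Matrix.diagonal G * Uᵀ := by
          simp only [Matrix.mul_assoc]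
      _ = U * Matrix.diagonal (fun i => F i * G i) * Uᵀ := by
          rw [hU, Matrix.mul_one, Matrix.mul_assoc U, Matrix.diagonal_mul_diagonal]
  have symm : ∀ F : n → ℝ, (U * Matrix.diagonal F * Uᵀ)ᵀ = U * Matrix.diagonal F * Uᵀ := by
    intro F
    rw [Matrix.transpose_mul, Matrix.transpose_mul, Matrix.transpose_transpose,
      Matrix.diagonal_transpose, Matrix.mul_assoc]
  refine ⟨U * Matrix.diagonal (fun i => (D i)⁻¹) * Uᵀ, ?_, ?_, ?_, ?_⟩
  · rw [hAU, key, key]; congr 3; funext i; by_cases h : D i = 0 <;> simp [h]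
  · rw [hAU, key, key]; congr 3; funext i; by_cases h : D i = 0 <;> simp [h]
  · rw [hAU, key, symm]
  · rw [hAU, key, symm]

/-- The pseudo inverse of a real square matrix. -/
def pseudoInverse (A : Matrix n n ℝ) : Matrix n n ℝ :=
  Classical.epsilon (IsPseudoInverse A)

/-- The pseudo inverse of a symmetric matrix satisfies the four Penrose equations. -/
theorem isPseudoInverse_pseudoInverse [DecidableEq n] {A : Matrix n n ℝ} (hA : A.IsSymm) :
    IsPseudoInverse A (pseudoInverse A) :=
  Classical.epsilon_spec (exists_isPseudoInverse hA)

end PseudoInverse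

/-! ### Metrized graphs -/

/-- A metrized graph on the space of points `X`, together with a vertex set, whose edges are
labelled by `E`. The edge `e` is the image of the segment `[0, len e]` under its distinguished
parametrization `param e`. (Only the restriction of `param e` to `[0, len e]` is relevant: a
continuous path on a segment extends continuously to `ℝ`, for instance by constants.)
Self-loops, multiple edges and vertices of valence `2` are allowed, and so is a graph that
consists of one vertex. -/
structure MetrizedGraph (X E : Type*) [TopologicalSpace X] where
  t2 : T2Space X
  connected : ConnectedSpace X
  /-- The vertex set. -/
  vertices : Finset X
  vertices_nonempty : vertices.Nonempty
  /-- The length of an edge. -/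
  len : E → ℝ
  len_pos : ∀ e, 0 < len e
  /-- The parametrization of an edge by arc length. -/
  param : E → ℝ → X
  continuous_param : ∀ e, Continuous (param e)
  param_zero_mem : ∀ e, param e 0 ∈ vertices
  param_len_mem : ∀ e, param e (len e) ∈ vertices
  param_interior_not_mem : ∀ e, ∀ t ∈ Ioo 0 (len e), param e t ∉ vertices
  param_interior_injective : ∀ e e', ∀ t ∈ Ioo 0 (len e), ∀ t' ∈ Ioo 0 (len e'),
    param e t = param e' t' → e = e' ∧ t = t'
  cover : ∀ x, x ∈ vertices ∨ ∃ e, ∃ t ∈ Ioo 0 (len e), param e t = x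

namespace MetrizedGraph

variable {X E : Type*} [TopologicalSpace X] (Γ : MetrizedGraph X E)

/-- The end point `p_e` of the edge `e`. -/
def src (e : E) : Γ.vertices := ⟨Γ.param e 0, Γ.param_zero_mem e⟩

/-- The end point `q_e` of the edge `e`. -/
def tgt (e : E) : Γ.vertices := ⟨Γ.param e (Γ.len e), Γ.param_len_mem e⟩

/-- The vertex set is optimal: there are no self-loops, and no multiple edges connecting any
two vertices. -/
structure IsOptimal : Prop where
  no_loops : ∀ e, Γ.src e ≠ Γ.tgt e
  no_multiple_edges : ∀ e e', s(Γ.src e, Γ.tgt e) = s(Γ.src e', Γ.tgt e') → e = e'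

/-- The directions at the point `p` along an edge `e`, in the sense of increasing parameter: the
pairs `(e, t)` such that `param e` passes through `p` at the time `t < len e`. -/
def forwardDirections (p : X) : Set (E × ℝ) :=
  {d | d.2 ∈ Ico 0 (Γ.len d.1) ∧ Γ.param d.1 d.2 = p}

/-- The directions at the point `p` along an edge `e`, in the sense of decreasing parameter: the
pairs `(e, t)` such that `param e` passes through `p` at the time `t > 0`. -/
def backwardDirections (p : X) : Set (E × ℝ) :=
  {d | d.2 ∈ Ioc 0 (Γ.len d.1) ∧ Γ.param d.1 d.2 = p}

/-- The valence of a point: the number of directions emanating from it. -/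
def valence (p : X) : ℕ := (Γ.forwardDirections p).ncard + (Γ.backwardDirections p).ncard

/-! ### The discrete Laplacian matrix -/

section Matrices

variable [Fintype E]

open Classical in
/-- The adjacency matrix: the entry at `(p, q)` is `1 / len e` if `p ≠ q` are connected by the
edge `e`, and `0` if `p = q` or if `p` and `q` are not adjacent. (If the vertex set is optimal
then the sum has at most one term.) -/
def adjMatrix : Matrix Γ.vertices Γ.vertices ℝ :=
  Matrix.of fun p q => if p = q then 0 else
    ∑ e with s(Γ.src e, Γ.tgt e) = s(p, q), 1 / Γ.len e

open Classical in
/-- The discrete Laplacian matrix `L = D - A`. -/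
def laplacianMatrix : Matrix Γ.vertices Γ.vertices ℝ :=
  Matrix.diagonal (fun p => ∑ s, Γ.adjMatrix p s) - Γ.adjMatrix

theorem isSymm_laplacianMatrix : Γ.laplacianMatrix.IsSymm := by
  classical
  have hA : Γ.adjMatrix.IsSymm := by
    ext p q
    simp only [Matrix.transpose_apply, adjMatrix, Matrix.of_apply, Sym2.eq_swap (a := q) (b := p),
      eq_comm (a := q) (b := p)]
  rw [Matrix.IsSymm, laplacianMatrix, Matrix.transpose_sub, Matrix.diagonal_transpose, hA]

/-- The pseudo inverse `L⁺` of the discrete Laplacian matrix. -/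
def laplacianPinv : Matrix Γ.vertices Γ.vertices ℝ := pseudoInverse Γ.laplacianMatrix

theorem isPseudoInverse_laplacianPinv :
    IsPseudoInverse Γ.laplacianMatrix Γ.laplacianPinv := by
  classical
  exact isPseudoInverse_pseudoInverse Γ.isSymm_laplacianMatrix

end Matrices

/-! ### The measure valued Laplacian -/

/-- The second derivative of `f` along the edge `e`. -/
def secondDeriv (f : X → ℝ) (e : E) : ℝ → ℝ := deriv (deriv fun t => f (Γ.param e t))

/-- The real-valued functions of the class `Zh(Γ)`, with respect to the vertex set `S`: they are
continuous on `Γ`, of class `C²` on `Γ \ S`, and their second derivative is integrable. -/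
structure IsZh (S : Finset X) (f : X → ℝ) : Prop where
  continuous : Continuous f
  contDiffOn : ∀ e, ContDiffOn ℝ 2 (fun t => f (Γ.param e t))
    {t | t ∈ Ioo 0 (Γ.len e) ∧ Γ.param e t ∉ S}
  integrableOn : ∀ e, IntegrableOn (Γ.secondDeriv f e) (Ioo 0 (Γ.len e))

/-- The sum of the directional derivatives of `f` at `p`, over all directions `v` at `p`. In the
direction of decreasing parameter, the derivative is minus the left derivative. -/
def sumDirDeriv (f : X → ℝ) (p : X) : ℝ :=
  (∑ᶠ d ∈ Γ.forwardDirections p, derivWithin (fun t => f (Γ.param d.1 t)) (Ioi d.2) d.2) +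
    ∑ᶠ d ∈ Γ.backwardDirections p, -derivWithin (fun t => f (Γ.param d.1 t)) (Iio d.2) d.2

variable [MeasurableSpace X]

/-- The Dirac measure, as a signed measure. -/
def dirac (p : X) : SignedMeasure X := (Measure.dirac p).toSignedMeasure

/-- The measure `g(x) dx` on the edge `e`, for a function `g` of the arc length parameter. -/
def edgeDensity (e : E) (g : ℝ → ℝ) : SignedMeasure X :=
  ((volume.restrict (Ioo 0 (Γ.len e))).withDensityᵥ g).map (Γ.param e)

/-- The measure `dx` on the edge `e`: the arc length measure. -/
def edgeLength (e : E) : SignedMeasure X := Γ.edgeDensity e fun _ => 1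

variable [Fintype E]

/-- The measure valued Laplacian of a function of the class `Zh(Γ)`, with respect to the vertex
set `S`: `Δ f = -f''(x) dx - ∑_{p ∈ S} (∑_v d_v f(p)) δ_p`. -/
def laplacian (S : Finset X) (f : X → ℝ) : SignedMeasure X :=
  -(∑ e, Γ.edgeDensity e (Γ.secondDeriv f e)) - ∑ p ∈ S, Γ.sumDirDeriv f p • dirac p

/-! ### The voltage function and the canonical measure -/

/-- `f` is the fundamental solution with pole `y` and base point `z`, i.e. the voltage, relative
to the voltage at `z`, when unit current enters at `y` and exits at `z`: `Δ f = δ_y - δ_z` and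
`f z = 0`. Here `S` is any vertex set of the metrized graph, obtained from the given one by
considering additional points as vertices. -/
def IsVoltage (z y : X) (f : X → ℝ) : Prop :=
  f z = 0 ∧ ∃ S : Finset X, Γ.vertices ⊆ S ∧ Γ.IsZh S f ∧ Γ.laplacian S f = dirac y - dirac z

/-- The voltage function `j_z(x, y)`. -/
def voltage (z x y : X) : ℝ := Classical.epsilon (Γ.IsVoltage z y) x

/-- The function `j_μ(x, y) = ∫ j_ζ(x, y) dμ(ζ)`. -/
def voltageIntegral (μ : SignedMeasure X) (x y : X) : ℝ :=
  ∫ᵛ ζ, Γ.voltage ζ x y ∂•μ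

/-- `μ` is a canonical measure: a signed measure of total mass `1` for which `j_μ(x, x)` is
constant on `Γ`. (A real-valued signed measure has finite total variation.) -/
def IsCanonicalMeasure (μ : SignedMeasure X) : Prop :=
  μ univ = 1 ∧ ∃ c : ℝ, ∀ x, Γ.voltageIntegral μ x x = c

end MetrizedGraph

end

open Filter Topology

/-! Everything is expressed through one explicit symmetric kernel. Let w(x) be the weights that
write x as an affine combination of the end points of its edge, and let n be the number of vertices.
Put g(x, y) = w(x)ᵀ L⁺ w(y) + ∑ₑ (min(s, t) - st/Lₑ), with s and t the arc length coordinates of x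
and y on e. The first term is affine along edges. The second is the Dirichlet Green function of each
edge separately and produces the unit kink at y. Since L L⁺ is the projection away from the
constants, Δₓ g(x, y) is δ_y minus a measure independent of y. Hence j_z(x, y) = g(x, y) - g(x, z) -
g(z, y) + g(z, z), once voltages are known to be unique (`IsVoltage.unique`,
`isVoltage_basedGreen`). On the diagonal j_z(x, x) = g(x, x) + g(z, z) - 2 g(x, z), so a measure of
mass 1 is canonical exactly when g(x, x) - 2 ∫ g(x, y) dμ(y) is constant (`isCanonicalMeasure_iff`).

Existence: for the measure of the formula, the quadratic terms along each edge cancel and this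
function is affine on every edge (`green_self_sub_integral_canonicalMeasure`). Its vertex values lie
in the kernel of L, by symmetry of L⁺ and Foster's theorem ∑ rₑ/Lₑ = n - 1, where rₑ is the
effective resistance between the end points (`laplacianMatrix_mulVec_canonicalPotential`). The
kernel consists of constants.

Uniqueness: the difference ν of two canonical measures has mass 0 and a constant potential ∫ g(x, y)
dν(y). Testing along an edge shows that ν does not charge edge interiors, and L L⁺ then kills the
vertex masses (`eq_zero_of_integral_green_const`). Optimality of the vertex set only serves to read
1/Lₑ off the matrix L. -/

namespace MetrizedGraph

variable {X E : Type*} [TopologicalSpace X] (Γ : MetrizedGraph X E)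

/-- A continuous function with finitely many values on a metrized graph is constant. -/
theorem eq_of_continuous_of_finite_range (Γ : MetrizedGraph X E) {f : X → ℝ} (hf : Continuous f)
    (hfin : (range f).Finite) (x y : X) : f x = f y := by
  have := Γ.connected
  have h := hfin.countable.isTotallyDisconnected (range f) Subset.rfl (isPreconnected_range hf)
  exact h (mem_range_self x) (mem_range_self y)

theorem card_vertices_ne_zero : (Γ.vertices.card : ℝ) ≠ 0 := by
  have := Γ.vertices_nonempty
  exact_mod_cast this.card_pos.ne'

/-! ### Linear algebra of the discrete Laplacian -/

section LinearAlgebra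

variable [Fintype E]

/-- Splits the unordered pair of end points into the two orientations, so that later sums run over
edges. Self-loops do no harm: their terms carry the factor u p - u p = 0. -/
theorem adjMatrix_apply_mul_sub [DecidableEq Γ.vertices] (u : Γ.vertices → ℝ) (p s : Γ.vertices) :
    Γ.adjMatrix p s * (u p - u s) =
      ∑ e, ((if Γ.src e = p ∧ Γ.tgt e = s then (u p - u s) / Γ.len e else 0) +
        if Γ.tgt e = p ∧ Γ.src e = s then (u p - u s) / Γ.len e else 0) := by
  classical
  by_cases hps : p = s
  · subst hps; simp
  · simp only [adjMatrix, Matrix.of_apply, if_neg hps, Finset.sum_filter, Finset.sum_mul]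
    refine Finset.sum_congr rfl fun e _ => ?_
    by_cases h1 : Γ.src e = p ∧ Γ.tgt e = s
    · obtain ⟨rfl, rfl⟩ := h1
      have : ¬ (Γ.tgt e = Γ.src e) := fun h => hps h.symm
      simp [this, div_eq_inv_mul]
    · by_cases h2 : Γ.tgt e = p ∧ Γ.src e = s
      · obtain ⟨rfl, rfl⟩ := h2
        rw [if_pos Sym2.eq_swap, if_neg h1, if_pos ⟨rfl, rfl⟩]
        ring
      · rw [if_neg h1, if_neg h2, if_neg]
        · ring
        · rw [Sym2.eq_iff]
          tauto

theorem laplacianMatrix_mulVec_eq_sum_adjMatrix (u : Γ.vertices → ℝ) (p : Γ.vertices) :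
    (Γ.laplacianMatrix *ᵥ u) p = ∑ s, Γ.adjMatrix p s * (u p - u s) := by
  classical
  rw [laplacianMatrix, Matrix.sub_mulVec, Pi.sub_apply]
  simp only [Matrix.mulVec, dotProduct, Matrix.diagonal_apply, ite_mul, zero_mul,
    Finset.sum_ite_eq, Finset.mem_univ, if_true, mul_sub, Finset.sum_sub_distrib, Finset.sum_mul]

/-- The discrete Laplacian applied to a function on the vertices, as a sum over the edges. -/
theorem laplacianMatrix_mulVec_apply [DecidableEq Γ.vertices] (u : Γ.vertices → ℝ)
    (p : Γ.vertices) :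
    (Γ.laplacianMatrix *ᵥ u) p =
      ∑ e, ((if Γ.src e = p then (u (Γ.src e) - u (Γ.tgt e)) / Γ.len e else 0) +
        if Γ.tgt e = p then (u (Γ.tgt e) - u (Γ.src e)) / Γ.len e else 0) := by
  simp only [laplacianMatrix_mulVec_eq_sum_adjMatrix, adjMatrix_apply_mul_sub]
  rw [Finset.sum_comm]
  refine Finset.sum_congr rfl fun e _ => ?_
  rw [Finset.sum_add_distrib]
  congr 1
  · by_cases hp : Γ.src e = p
    · subst hp; simp
    · simp [hp]
  · by_cases hp : Γ.tgt e = p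
    · subst hp; simp
    · simp [hp]

/-- Summation by parts: the Dirichlet form of L. Its positivity determines the kernel of L. -/
theorem dotProduct_laplacianMatrix_mulVec (u w : Γ.vertices → ℝ) :
    u ⬝ᵥ (Γ.laplacianMatrix *ᵥ w) =
      ∑ e, (u (Γ.src e) - u (Γ.tgt e)) * (w (Γ.src e) - w (Γ.tgt e)) / Γ.len e := by
  classical
  simp only [dotProduct, laplacianMatrix_mulVec_apply, Finset.mul_sum]
  rw [Finset.sum_comm]
  refine Finset.sum_congr rfl fun e _ => ?_
  simp only [mul_add, mul_ite, mul_zero, Finset.sum_add_distrib, Finset.sum_ite_eq,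
    Finset.mem_univ, if_true]
  ring

theorem eq_of_laplacianMatrix_mulVec_eq_zero {u : Γ.vertices → ℝ}
    (hu : Γ.laplacianMatrix *ᵥ u = 0) (e : E) : u (Γ.src e) = u (Γ.tgt e) := by
  have h := Γ.dotProduct_laplacianMatrix_mulVec u u
  rw [hu, dotProduct_zero, eq_comm, Finset.sum_eq_zero_iff_of_nonneg] at h
  · have h1 := h e (Finset.mem_univ e)
    have h2 := (Γ.len_pos e).ne'
    rw [div_eq_zero_iff, or_iff_left h2, mul_self_eq_zero, sub_eq_zero] at h1
    exact h1
  · intro e _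
    exact div_nonneg (mul_self_nonneg _) (Γ.len_pos e).le

/-- Transposing the Penrose equations of a symmetric matrix permutes them, so the transpose is again
a pseudo inverse, and that is unique. -/
theorem isSymm_laplacianPinv : Γ.laplacianPinv.IsSymm := by
  have h := Γ.isPseudoInverse_laplacianPinv
  have hL : Γ.laplacianMatrixᵀ = Γ.laplacianMatrix := Γ.isSymm_laplacianMatrix
  refine IsPseudoInverse.unique (A := Γ.laplacianMatrix) ⟨?_, ?_, ?_, ?_⟩ h
  · have := congrArg Matrix.transpose h.mul_mul_left
    simpa only [Matrix.transpose_mul, hL, Matrix.mul_assoc] using this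
  · have := congrArg Matrix.transpose h.mul_mul_right
    simpa only [Matrix.transpose_mul, hL, Matrix.mul_assoc] using this
  · have := h.transpose_right
    rw [Matrix.transpose_mul, hL] at this
    rw [this, h.transpose_right]
  · have := h.transpose_left
    rw [Matrix.transpose_mul, hL] at this
    rw [this, h.transpose_left]

theorem laplacianMatrix_mul_laplacianPinv_comm :
    Γ.laplacianMatrix * Γ.laplacianPinv = Γ.laplacianPinv * Γ.laplacianMatrix := by
  have h := Γ.isPseudoInverse_laplacianPinv.transpose_left
  rw [Matrix.transpose_mul, Γ.isSymm_laplacianPinv, Γ.isSymm_laplacianMatrix] at h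
  exact h.symm

end LinearAlgebra

/-! ### The coordinates of a point and interpolation along the edges -/

theorem param_interior_unique {e e' : E} {t t' : ℝ} (ht : t ∈ Ioo 0 (Γ.len e))
    (ht' : t' ∈ Ioo 0 (Γ.len e')) (h : Γ.param e t = Γ.param e' t') : e = e' ∧ t = t' :=
  Γ.param_interior_injective e e' t ht t' ht' h

theorem param_eq_vertex {e : E} {t : ℝ} (ht : t ∈ Icc 0 (Γ.len e))
    (h : Γ.param e t ∈ Γ.vertices) : t = 0 ∨ t = Γ.len e := by
  by_contra! hne
  exact Γ.param_interior_not_mem e t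
    ⟨lt_of_le_of_ne ht.1 (Ne.symm hne.1), lt_of_le_of_ne ht.2 hne.2⟩ h

open Classical in
/-- The arc length parameter of a point in the interior of the edge `e`, and `0` at the points
outside of the interior of `e`. -/
noncomputable def coord (e : E) (x : X) : ℝ :=
  if h : ∃ t ∈ Ioo 0 (Γ.len e), Γ.param e t = x then h.choose else 0

theorem coord_param {e : E} {t : ℝ} (ht : t ∈ Ioo 0 (Γ.len e)) :
    Γ.coord e (Γ.param e t) = t := by
  have h : ∃ s ∈ Ioo 0 (Γ.len e), Γ.param e s = Γ.param e t := ⟨t, ht, rfl⟩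
  rw [coord, dif_pos h]
  exact (Γ.param_interior_unique h.choose_spec.1 ht h.choose_spec.2).2

theorem coord_param_of_ne {e e' : E} (hne : e ≠ e') {t : ℝ} (ht : t ∈ Ioo 0 (Γ.len e')) :
    Γ.coord e (Γ.param e' t) = 0 := by
  rw [coord, dif_neg]
  rintro ⟨s, hs, h⟩
  exact hne (Γ.param_interior_unique hs ht h).1

theorem coord_vertex (e : E) {x : X} (hx : x ∈ Γ.vertices) : Γ.coord e x = 0 := by
  rw [coord, dif_neg]
  rintro ⟨s, hs, rfl⟩
  exact Γ.param_interior_not_mem e s hs hx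

theorem param_coord {e : E} {x : X} (h : 0 < Γ.coord e x) : Γ.param e (Γ.coord e x) = x := by
  rw [coord] at h ⊢
  split_ifs at h ⊢ with h'
  · exact h'.choose_spec.2
  · exact absurd h (lt_irrefl _)

theorem coord_mem (e : E) (x : X) : Γ.coord e x ∈ Ico 0 (Γ.len e) := by
  rw [coord]
  split_ifs with h
  · exact ⟨h.choose_spec.1.1.le, h.choose_spec.1.2⟩
  · exact ⟨le_rfl, Γ.len_pos e⟩

theorem coord_eq_zero_of_param_endpoint {e e' : E} {t : ℝ} (ht : t ∈ Icc 0 (Γ.len e))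
    (ht' : t ∉ Ioo 0 (Γ.len e)) : Γ.coord e' (Γ.param e t) = 0 := by
  apply Γ.coord_vertex
  rcases eq_or_lt_of_le ht.1 with h | h
  · rw [← h]; exact Γ.param_zero_mem e
  · rcases eq_or_lt_of_le ht.2 with h' | h'
    · rw [h']; exact Γ.param_len_mem e
    · exact absurd ⟨h, h'⟩ ht'

variable [Fintype E]

open Classical in
/-- The weight of the vertex `p` in the affine interpolation, along the edges, to the point `x`. -/
noncomputable def weight (x : X) (p : Γ.vertices) : ℝ :=
  (if (p : X) = x then 1 else 0) + ∑ e, if 0 < Γ.coord e x then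
    (if Γ.src e = p then 1 - Γ.coord e x / Γ.len e else 0) +
      (if Γ.tgt e = p then Γ.coord e x / Γ.len e else 0) else 0

/-- The function that is affine along each edge, with the given values at the vertices. -/
noncomputable def interp (u : Γ.vertices → ℝ) (x : X) : ℝ := Γ.weight x ⬝ᵥ u

theorem interp_vertex (u : Γ.vertices → ℝ) (p : Γ.vertices) : Γ.interp u p = u p := by
  classical
  simp only [interp, dotProduct, weight, Γ.coord_vertex _ p.2, lt_irrefl, if_false,
    Finset.sum_const_zero, add_zero, ite_mul, one_mul, zero_mul, Subtype.coe_inj]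
  simp

theorem interp_param_interior (u : Γ.vertices → ℝ) {e : E} {t : ℝ} (ht : t ∈ Ioo 0 (Γ.len e)) :
    Γ.interp u (Γ.param e t) =
      (1 - t / Γ.len e) * u (Γ.src e) + t / Γ.len e * u (Γ.tgt e) := by
  classical
  have h0 : ∀ p : Γ.vertices, (p : X) ≠ Γ.param e t := fun p h =>
    Γ.param_interior_not_mem e t ht (h ▸ p.2)
  have h1 : ∀ p, Γ.weight (Γ.param e t) p =
      (if Γ.src e = p then 1 - t / Γ.len e else 0) + (if Γ.tgt e = p then t / Γ.len e else 0) := by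
    intro p
    rw [weight, if_neg (h0 p), zero_add, Finset.sum_eq_single e]
    · rw [Γ.coord_param ht, if_pos ht.1]
    · intro e' _ hne
      rw [Γ.coord_param_of_ne hne ht, if_neg (lt_irrefl _)]
    · simp
  simp only [interp, dotProduct, h1, add_mul, ite_mul, zero_mul, Finset.sum_add_distrib,
    Finset.sum_ite_eq, Finset.mem_univ, if_true]

theorem interp_param (u : Γ.vertices → ℝ) {e : E} {t : ℝ} (ht : t ∈ Icc 0 (Γ.len e)) :
    Γ.interp u (Γ.param e t) =
      (1 - t / Γ.len e) * u (Γ.src e) + t / Γ.len e * u (Γ.tgt e) := by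
  by_cases h : t ∈ Ioo 0 (Γ.len e)
  · exact Γ.interp_param_interior u h
  · have hL := (Γ.len_pos e).ne'
    rcases eq_or_lt_of_le ht.1 with h0 | h0
    · subst h0
      simpa [src] using Γ.interp_vertex u (Γ.src e)
    · have h1 : t = Γ.len e := by
        by_contra hne
        exact h ⟨h0, lt_of_le_of_ne ht.2 hne⟩
      subst h1
      simpa [hL, tgt] using Γ.interp_vertex u (Γ.tgt e)

theorem sum_weight (x : X) : ∑ p, Γ.weight x p = 1 := by
  have h : ∑ p, Γ.weight x p = Γ.interp (fun _ => 1) x := by simp [interp, dotProduct]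
  rw [h]
  rcases Γ.cover x with hx | ⟨e, t, ht, rfl⟩
  · exact Γ.interp_vertex (fun _ => 1) ⟨x, hx⟩
  · rw [Γ.interp_param_interior _ ht]; ring

/-- Continuity on a metrized graph can be tested along the edges. -/
theorem continuous_of_continuousOn_param {Y : Type*} [TopologicalSpace Y] {f : X → Y}
    (hf : ∀ e, ContinuousOn (fun t => f (Γ.param e t)) (Icc 0 (Γ.len e))) : Continuous f := by
  have := Γ.t2
  rw [continuous_iff_isClosed]
  intro C hC
  -- The space is a finite union of compact pieces, so a closed set is recovered from its compact
  -- traces on the edges and its finite trace on the vertices.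
  have h : f ⁻¹' C = (Γ.vertices ∩ f ⁻¹' C : Set X) ∪
      ⋃ e, Γ.param e '' (Icc 0 (Γ.len e) ∩ (fun t => f (Γ.param e t)) ⁻¹' C) := by
    ext x
    simp only [mem_preimage, mem_union, mem_inter_iff, Finset.mem_coe, mem_iUnion, mem_image]
    constructor
    · intro hx
      rcases Γ.cover x with hv | ⟨e, t, ht, rfl⟩
      · exact Or.inl ⟨hv, hx⟩
      · exact Or.inr ⟨e, t, ⟨Ioo_subset_Icc_self ht, hx⟩, rfl⟩
    · rintro (⟨_, hx⟩ | ⟨e, t, ⟨_, hx⟩, rfl⟩)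
      · exact hx
      · exact hx
  rw [h]
  refine IsClosed.union (Γ.vertices.finite_toSet.inter_of_left _).isClosed ?_
  refine isClosed_iUnion_of_finite fun e => IsCompact.isClosed ?_
  refine IsCompact.image ?_ (Γ.continuous_param e)
  exact isCompact_Icc.of_isClosed_subset
    ((hf e).preimage_isClosed_of_isClosed isClosed_Icc hC) inter_subset_left

theorem compactSpace (Γ : MetrizedGraph X E) : CompactSpace X := by
  constructor
  have h : (univ : Set X) = (Γ.vertices : Set X) ∪ ⋃ e, Γ.param e '' Icc 0 (Γ.len e) := by
    symm
    rw [eq_univ_iff_forall]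
    intro x
    rcases Γ.cover x with hv | ⟨e, t, ht, rfl⟩
    · exact Or.inl hv
    · exact Or.inr (mem_iUnion.2 ⟨e, t, Ioo_subset_Icc_self ht, rfl⟩)
  rw [h]
  exact Γ.vertices.finite_toSet.isCompact.union
    (isCompact_iUnion fun e => isCompact_Icc.image (Γ.continuous_param e))

theorem continuous_interp (u : Γ.vertices → ℝ) : Continuous (Γ.interp u) := by
  refine Γ.continuous_of_continuousOn_param fun e => ?_
  refine ContinuousOn.congr (f := fun t => (1 - t / Γ.len e) * u (Γ.src e) +
    t / Γ.len e * u (Γ.tgt e)) ?_ fun t ht => Γ.interp_param u ht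
  exact Continuous.continuousOn (by fun_prop)

/-- The kernel of the discrete Laplacian consists of the constants. -/
theorem const_of_laplacianMatrix_mulVec_eq_zero {u : Γ.vertices → ℝ}
    (hu : Γ.laplacianMatrix *ᵥ u = 0) (p q : Γ.vertices) : u p = u q := by
  -- Connectedness is assumed of the space only. It reaches the vertices through the interpolation
  -- of u, which is continuous and, being constant on each edge, takes only the finitely many values
  -- of u.
  have h := Γ.eq_of_continuous_of_finite_range (Γ.continuous_interp u)
    ((Set.finite_range u).subset ?_) p q
  · simpa only [Γ.interp_vertex] using h
  · rintro _ ⟨x, rfl⟩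
    rcases Γ.cover x with hx | ⟨e, t, ht, rfl⟩
    · exact ⟨⟨x, hx⟩, (Γ.interp_vertex u ⟨x, hx⟩).symm⟩
    · refine ⟨Γ.src e, ?_⟩
      rw [Γ.interp_param_interior u ht, ← Γ.eq_of_laplacianMatrix_mulVec_eq_zero hu e]
      ring

theorem laplacianMatrix_mulVec_one : Γ.laplacianMatrix *ᵥ (fun _ => 1) = 0 := by
  classical
  funext p
  simp [laplacianMatrix_mulVec_apply]

/-- `L L⁺` is the orthogonal projection to the complement of the constants. -/
theorem laplacianMatrix_mul_laplacianPinv_apply [DecidableEq Γ.vertices] (p q : Γ.vertices) :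
    (Γ.laplacianMatrix * Γ.laplacianPinv) p q =
      (if p = q then 1 else 0) - 1 / (Γ.vertices.card : ℝ) := by
  set L := Γ.laplacianMatrix with hL
  set P := Γ.laplacianPinv with hP
  have hpi := Γ.isPseudoInverse_laplacianPinv
  -- The columns of Q lie in the kernel of L, hence are constant. As Q is symmetric, all its entries
  -- agree, and Q fixes the constant vector 1, so each entry is 1 / card.
  set Q : Matrix Γ.vertices Γ.vertices ℝ := 1 - L * P with hQ
  have hLQ : L * Q = 0 := by
    rw [hQ, Matrix.mul_sub, Matrix.mul_one, Γ.laplacianMatrix_mul_laplacianPinv_comm,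
      ← Matrix.mul_assoc, hpi.mul_mul_left, sub_self]
  have hQsymm : Qᵀ = Q := by
    rw [hQ, Matrix.transpose_sub, Matrix.transpose_one, hpi.transpose_left]
  have hQcol : ∀ a b c, Q a c = Q b c := by
    intro a b c
    refine Γ.const_of_laplacianMatrix_mulVec_eq_zero (u := fun a => Q a c) ?_ a b
    funext a
    have := congrFun (congrFun hLQ a) c
    simpa [Matrix.mul_apply, Matrix.mulVec, dotProduct] using this
  have hQconst : ∀ a b, Q a b = Q p q := by
    intro a b
    have h1 : ∀ a b, Q a b = Q b a := fun a b => by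
      conv_lhs => rw [← hQsymm]
      rfl
    rw [hQcol a q b, h1, hQcol b p q]
  have hone : Q *ᵥ (fun _ => 1) = fun _ => 1 := by
    rw [hQ, Matrix.sub_mulVec, Matrix.one_mulVec, Γ.laplacianMatrix_mul_laplacianPinv_comm,
      ← Matrix.mulVec_mulVec, Γ.laplacianMatrix_mulVec_one, Matrix.mulVec_zero, sub_zero]
  have hcard : (Γ.vertices.card : ℝ) * Q p q = 1 := by
    have := congrFun hone p
    simpa [Matrix.mulVec, dotProduct, hQconst] using this
  have hval : Q p q = 1 / (Γ.vertices.card : ℝ) := by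
    rw [eq_div_iff Γ.card_vertices_ne_zero, mul_comm, hcard]
  have h2 : (L * P) p q = (1 : Matrix _ _ ℝ) p q - Q p q := by
    rw [hQ]; simp
  rw [h2, hval, Matrix.one_apply]

theorem laplacianMatrix_mulVec_laplacianPinv_mulVec (u : Γ.vertices → ℝ) (p : Γ.vertices) :
    (Γ.laplacianMatrix *ᵥ (Γ.laplacianPinv *ᵥ u)) p = u p - (∑ q, u q) / Γ.vertices.card := by
  classical
  rw [Matrix.mulVec_mulVec]
  simp only [Matrix.mulVec, dotProduct, laplacianMatrix_mul_laplacianPinv_apply, sub_mul, ite_mul,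
    one_mul, zero_mul, Finset.sum_sub_distrib, Finset.sum_ite_eq, Finset.mem_univ, if_true,
    ← Finset.mul_sum]
  ring

/-- The effective resistance between the end points of an edge. -/
noncomputable def edgeResistance (e : E) : ℝ :=
  Γ.laplacianPinv (Γ.src e) (Γ.src e) - 2 * Γ.laplacianPinv (Γ.src e) (Γ.tgt e) +
    Γ.laplacianPinv (Γ.tgt e) (Γ.tgt e)

/-- Foster's theorem. -/
theorem sum_edgeResistance_div_len :
    ∑ e, Γ.edgeResistance e / Γ.len e = Γ.vertices.card - 1 := by
  classical
  -- The number card - 1 is the trace of the projection L L⁺. Expanding its diagonal over edges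
  -- collects the resistances.
  have h1 : ∑ p, (Γ.laplacianMatrix * Γ.laplacianPinv) p p = (Γ.vertices.card : ℝ) - 1 := by
    simp only [laplacianMatrix_mul_laplacianPinv_apply, if_true, Finset.sum_const,
      Finset.card_univ, Fintype.card_coe, nsmul_eq_mul]
    field_simp [Γ.card_vertices_ne_zero]
  rw [← h1]
  have h2 : ∀ p, (Γ.laplacianMatrix * Γ.laplacianPinv) p p =
      (Γ.laplacianMatrix *ᵥ fun q => Γ.laplacianPinv q p) p := fun p => rfl
  simp only [h2, laplacianMatrix_mulVec_apply]
  rw [Finset.sum_comm]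
  refine Finset.sum_congr rfl fun e _ => ?_
  simp only [Finset.sum_add_distrib, Finset.sum_ite_eq, Finset.mem_univ, if_true]
  rw [edgeResistance, Γ.isSymm_laplacianPinv.apply (Γ.src e) (Γ.tgt e)]
  ring

/-! ### The Green function -/

/-- The sum of the Dirichlet Green functions of the edges. -/
noncomputable def localGreen (x y : X) : ℝ :=
  ∑ e, (min (Γ.coord e x) (Γ.coord e y) - Γ.coord e x * Γ.coord e y / Γ.len e)

theorem localGreen_comm (x y : X) : Γ.localGreen x y = Γ.localGreen y x := by
  simp only [localGreen, min_comm, mul_comm]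

theorem localGreen_vertex {x : X} (hx : x ∈ Γ.vertices) (y : X) : Γ.localGreen x y = 0 := by
  refine Finset.sum_eq_zero fun e _ => ?_
  rw [Γ.coord_vertex e hx, min_eq_left (Γ.coord_mem e y).1]
  simp

theorem localGreen_param_interior {e : E} {t : ℝ} (ht : t ∈ Ioo 0 (Γ.len e)) (y : X) :
    Γ.localGreen (Γ.param e t) y = min t (Γ.coord e y) - t * Γ.coord e y / Γ.len e := by
  rw [localGreen, Finset.sum_eq_single e]
  · rw [Γ.coord_param ht]
  · intro e' _ hne
    rw [Γ.coord_param_of_ne hne ht, min_eq_left (Γ.coord_mem e' y).1]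
    simp
  · simp

/-- The formula in t persists at t = `len e`, although `coord` falls back to 0 there, because the
Dirichlet kernel vanishes at both ends. -/
theorem localGreen_param {e : E} {t : ℝ} (ht : t ∈ Icc 0 (Γ.len e)) (y : X) :
    Γ.localGreen (Γ.param e t) y = min t (Γ.coord e y) - t * Γ.coord e y / Γ.len e := by
  by_cases h : t ∈ Ioo 0 (Γ.len e)
  · exact Γ.localGreen_param_interior h y
  · have hc := Γ.coord_mem e y
    have hL := (Γ.len_pos e).ne'
    rcases eq_or_lt_of_le ht.1 with h0 | h0
    · subst h0
      rw [Γ.localGreen_vertex (Γ.param_zero_mem e), min_eq_left hc.1]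
      simp
    · have h1 : t = Γ.len e := by
        by_contra hne
        exact h ⟨h0, lt_of_le_of_ne ht.2 hne⟩
      subst h1
      rw [Γ.localGreen_vertex (Γ.param_len_mem e), min_eq_right hc.2.le]
      field_simp
      simp

theorem continuous_localGreen_left (y : X) : Continuous fun x => Γ.localGreen x y := by
  refine Γ.continuous_of_continuousOn_param fun e => ?_
  refine ContinuousOn.congr (f := fun t => min t (Γ.coord e y) - t * Γ.coord e y / Γ.len e) ?_
    fun t ht => Γ.localGreen_param ht y
  exact Continuous.continuousOn (by fun_prop)

/-- The Green function: `Δ_x g(x, y)` is `δ_y` minus the normalized counting measure of the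
vertices. -/
noncomputable def green (x y : X) : ℝ :=
  Γ.interp (Γ.laplacianPinv *ᵥ Γ.weight y) x + Γ.localGreen x y

theorem green_comm (x y : X) : Γ.green x y = Γ.green y x := by
  rw [green, green, Γ.localGreen_comm, interp, interp, Matrix.dotProduct_mulVec,
    ← Matrix.mulVec_transpose, Γ.isSymm_laplacianPinv, dotProduct_comm]

theorem continuous_green_left (y : X) : Continuous fun x => Γ.green x y :=
  (Γ.continuous_interp _).add (Γ.continuous_localGreen_left y)

theorem continuous_green_right (x : X) : Continuous fun y => Γ.green x y := by
  simpa only [Γ.green_comm x] using Γ.continuous_green_left x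

end MetrizedGraph

/-! ### One-sided derivatives of affine functions -/

theorem hasDerivWithinAt_of_eventually_affine {φ : ℝ → ℝ} {s : Set ℝ} {t c : ℝ}
    (h : ∀ᶠ x in 𝓝[s] t, φ x = φ t + c * (x - t)) : HasDerivWithinAt φ c s t := by
  have h1 : HasDerivWithinAt (fun x => φ t + c * (x - t)) c s t := by
    simpa using (((hasDerivWithinAt_id t s).sub_const t).const_mul c).const_add (φ t)
  exact h1.congr_of_eventuallyEq h (by simp)

theorem derivWithin_Ioi_of_eventually_affine {φ : ℝ → ℝ} {t c : ℝ}
    (h : ∀ᶠ x in 𝓝[>] t, φ x = φ t + c * (x - t)) : derivWithin φ (Ioi t) t = c :=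
  (hasDerivWithinAt_of_eventually_affine h).derivWithin (uniqueDiffWithinAt_Ioi t)

theorem derivWithin_Iio_of_eventually_affine {φ : ℝ → ℝ} {t c : ℝ}
    (h : ∀ᶠ x in 𝓝[<] t, φ x = φ t + c * (x - t)) : derivWithin φ (Iio t) t = c :=
  (hasDerivWithinAt_of_eventually_affine h).derivWithin (uniqueDiffWithinAt_Iio t)

theorem eventually_affine_nhds {φ : ℝ → ℝ} {t c : ℝ}
    (hl : ∀ᶠ x in 𝓝[<] t, φ x = φ t + c * (x - t))
    (hr : ∀ᶠ x in 𝓝[>] t, φ x = φ t + c * (x - t)) :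
    ∀ᶠ x in 𝓝 t, φ x = φ t + c * (x - t) := by
  rw [← nhdsNE_sup_pure t, eventually_sup, ← nhdsLT_sup_nhdsGT, eventually_sup]
  exact ⟨⟨hl, hr⟩, by simp⟩

theorem deriv_eventuallyEq_of_eventually_affine {φ : ℝ → ℝ} {t c : ℝ}
    (h : ∀ᶠ x in 𝓝 t, φ x = φ t + c * (x - t)) : deriv φ =ᶠ[𝓝 t] fun _ => c := by
  filter_upwards [h.eventually_nhds] with s hs
  have h1 : HasDerivAt (fun x => φ t + c * (x - t)) c s := by
    simpa using (((hasDerivAt_id s).sub_const t).const_mul c).const_add (φ t)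
  exact (h1.congr_of_eventuallyEq hs).deriv

theorem affine_of_hasDerivAt_const {φ : ℝ → ℝ} {a b c : ℝ} (hc : ContinuousOn φ (Icc a b))
    (hd : ∀ t ∈ Ioo a b, HasDerivAt φ c t) {s t : ℝ} (hs : s ∈ Icc a b) (ht : t ∈ Icc a b) :
    φ t = φ s + c * (t - s) := by
  have key : ∀ s t, s ∈ Icc a b → t ∈ Icc a b → s < t → φ t = φ s + c * (t - s) := by
    intro s t hs ht hst
    obtain ⟨x, _, hx⟩ := exists_hasDerivAt_eq_slope φ (fun _ => c) hst
      (hc.mono (Icc_subset_Icc hs.1 ht.2)) fun x hx =>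
        hd x ⟨hs.1.trans_lt hx.1, hx.2.trans_le ht.2⟩
    rw [eq_div_iff (sub_pos.2 hst).ne'] at hx
    linarith
  rcases lt_trichotomy s t with h | h | h
  · exact key s t hs ht h
  · subst h; ring
  · have := key t s ht hs h
    linarith

/-- Here the slope is 1 for t < a, while on the left it is 1 for t ≤ a. The discrepancy at t = a is
the unit kink that becomes a Dirac mass. -/
theorem eventually_min_right (t a : ℝ) :
    ∀ᶠ x in 𝓝[>] t, min x a = min t a + (if t < a then 1 else 0) * (x - t) := by
  split_ifs with h
  · filter_upwards [nhdsWithin_le_nhds (eventually_lt_nhds h)] with x hx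
    rw [min_eq_left hx.le, min_eq_left h.le]; ring
  · filter_upwards [self_mem_nhdsWithin] with x hx
    have hx' : t < x := hx
    rw [min_eq_right (not_lt.1 h), min_eq_right ((not_lt.1 h).trans hx'.le)]; ring

theorem eventually_min_left (t a : ℝ) :
    ∀ᶠ x in 𝓝[<] t, min x a = min t a + (if t ≤ a then 1 else 0) * (x - t) := by
  split_ifs with h
  · filter_upwards [self_mem_nhdsWithin] with x hx
    have hx' : x < t := hx
    rw [min_eq_left (hx'.le.trans h), min_eq_left h]; ring
  · filter_upwards [nhdsWithin_le_nhds (eventually_gt_nhds (not_le.1 h))] with x hx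
    rw [min_eq_right hx.le, min_eq_right (not_le.1 h).le]; ring

namespace MetrizedGraph

variable {X E : Type*} [TopologicalSpace X] (Γ : MetrizedGraph X E)

/-! ### Directions -/

theorem forwardDirections_vertex (p : Γ.vertices) :
    Γ.forwardDirections p = (fun e => (e, (0 : ℝ))) '' {e | Γ.src e = p} := by
  ext ⟨e, t⟩
  simp only [forwardDirections, mem_ofPred_eq, mem_image, Prod.mk.injEq]
  constructor
  · rintro ⟨ht, h⟩
    have h0 : t = 0 := by
      rcases Γ.param_eq_vertex (Ico_subset_Icc_self ht) (h ▸ p.2) with h0 | h0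
      · exact h0
      · exact absurd h0 ht.2.ne
    subst h0
    exact ⟨e, Subtype.ext h, rfl, rfl⟩
  · rintro ⟨e', he, rfl, rfl⟩
    exact ⟨⟨le_rfl, Γ.len_pos _⟩, congrArg Subtype.val he⟩

theorem backwardDirections_vertex (p : Γ.vertices) :
    Γ.backwardDirections p = (fun e => (e, Γ.len e)) '' {e | Γ.tgt e = p} := by
  ext ⟨e, t⟩
  simp only [backwardDirections, mem_ofPred_eq, mem_image, Prod.mk.injEq]
  constructor
  · rintro ⟨ht, h⟩
    have h0 : t = Γ.len e := by
      rcases Γ.param_eq_vertex (Ioc_subset_Icc_self ht) (h ▸ p.2) with h0 | h0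
      · exact absurd h0 ht.1.ne'
      · exact h0
    subst h0
    exact ⟨e, Subtype.ext h, rfl, rfl⟩
  · rintro ⟨e', he, rfl, rfl⟩
    exact ⟨⟨Γ.len_pos _, le_rfl⟩, congrArg Subtype.val he⟩

theorem eq_of_param_eq_interior {e e' : E} {s t : ℝ} (ht : t ∈ Ioo 0 (Γ.len e))
    (hs : s ∈ Icc 0 (Γ.len e')) (h : Γ.param e' s = Γ.param e t) : e' = e ∧ s = t := by
  have hs' : s ∈ Ioo 0 (Γ.len e') := by
    have hne : Γ.param e' s ∉ Γ.vertices := h ▸ Γ.param_interior_not_mem e t ht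
    constructor
    · refine lt_of_le_of_ne hs.1 fun h0 => hne ?_
      rw [← h0]; exact Γ.param_zero_mem e'
    · refine lt_of_le_of_ne hs.2 fun h0 => hne ?_
      rw [h0]; exact Γ.param_len_mem e'
  exact Γ.param_interior_unique hs' ht h

theorem forwardDirections_interior {e : E} {t : ℝ} (ht : t ∈ Ioo 0 (Γ.len e)) :
    Γ.forwardDirections (Γ.param e t) = {(e, t)} := by
  ext ⟨e', s⟩
  simp only [forwardDirections, mem_ofPred_eq, mem_singleton_iff, Prod.mk.injEq]
  constructor
  · rintro ⟨hs, h⟩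
    exact Γ.eq_of_param_eq_interior ht (Ico_subset_Icc_self hs) h
  · rintro ⟨rfl, rfl⟩
    exact ⟨Ioo_subset_Ico_self ht, rfl⟩

theorem backwardDirections_interior {e : E} {t : ℝ} (ht : t ∈ Ioo 0 (Γ.len e)) :
    Γ.backwardDirections (Γ.param e t) = {(e, t)} := by
  ext ⟨e', s⟩
  simp only [backwardDirections, mem_ofPred_eq, mem_singleton_iff, Prod.mk.injEq]
  constructor
  · rintro ⟨hs, h⟩
    exact Γ.eq_of_param_eq_interior ht (Ioc_subset_Icc_self hs) h
  · rintro ⟨rfl, rfl⟩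
    exact ⟨Ioo_subset_Ioc_self ht, rfl⟩

theorem sumDirDeriv_interior (f : X → ℝ) {e : E} {t : ℝ} (ht : t ∈ Ioo 0 (Γ.len e)) :
    Γ.sumDirDeriv f (Γ.param e t) = derivWithin (fun s => f (Γ.param e s)) (Ioi t) t -
      derivWithin (fun s => f (Γ.param e s)) (Iio t) t := by
  rw [sumDirDeriv, Γ.forwardDirections_interior ht, Γ.backwardDirections_interior ht,
    finsum_mem_singleton, finsum_mem_singleton, ← sub_eq_add_neg]

theorem sumDirDeriv_vertex [Fintype E] [DecidableEq Γ.vertices] (f : X → ℝ) (p : Γ.vertices) :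
    Γ.sumDirDeriv f p =
      ∑ e, ((if Γ.src e = p then derivWithin (fun s => f (Γ.param e s)) (Ioi 0) 0 else 0) -
        if Γ.tgt e = p then
          derivWithin (fun s => f (Γ.param e s)) (Iio (Γ.len e)) (Γ.len e) else 0) := by
  rw [sumDirDeriv, Γ.forwardDirections_vertex, Γ.backwardDirections_vertex,
    finsum_mem_image fun a _ b _ h => congrArg Prod.fst h,
    finsum_mem_image fun a _ b _ h => congrArg Prod.fst h,
    finsum_mem_def, finsum_mem_def, finsum_eq_sum_of_fintype, finsum_eq_sum_of_fintype,
    Finset.sum_sub_distrib, sub_eq_add_neg, ← Finset.sum_neg_distrib]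
  congr 1
  · refine Finset.sum_congr rfl fun e _ => ?_
    by_cases h : Γ.src e = p <;> simp [Set.indicator, h]
  · refine Finset.sum_congr rfl fun e _ => ?_
    by_cases h : Γ.tgt e = p <;> simp [Set.indicator, h]

theorem valence_vertex [Fintype E] [DecidableEq Γ.vertices] (p : Γ.vertices) :
    (Γ.valence p : ℝ) =
      ∑ e, ((if Γ.src e = p then 1 else 0) + if Γ.tgt e = p then 1 else 0) := by
  rw [valence, Γ.forwardDirections_vertex, Γ.backwardDirections_vertex,
    ncard_image_of_injective _ fun a b h => congrArg Prod.fst h,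
    ncard_image_of_injective _ fun a b h => congrArg Prod.fst h, Finset.sum_add_distrib,
    Finset.sum_boole, Finset.sum_boole]
  push_cast
  congr 2
  · rw [ncard_eq_toFinset_card', Set.toFinset_ofPred]
  · rw [ncard_eq_toFinset_card', Set.toFinset_ofPred]

/-! ### Evaluation of the measures -/

variable [MeasurableSpace X]

open Classical in
theorem dirac_apply {X : Type*} [MeasurableSpace X] (p : X) {A : Set X} (hA : MeasurableSet A) :
    dirac p A = if p ∈ A then 1 else 0 := by
  rw [dirac, Measure.toSignedMeasure_apply_measurable hA, measureReal_def,
    Measure.dirac_apply' p hA]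
  by_cases h : p ∈ A <;> simp [h]

theorem edgeDensity_eq_zero {e : E} {g : ℝ → ℝ}
    (hg : g =ᵐ[volume.restrict (Ioo 0 (Γ.len e))] 0) : Γ.edgeDensity e g = 0 := by
  rw [edgeDensity, WithDensityᵥEq.congr_ae hg, withDensityᵥ_zero, VectorMeasure.map_zero]

variable [BorelSpace X]

theorem edgeDensity_apply {e : E} {g : ℝ → ℝ} (hg : IntegrableOn g (Ioo 0 (Γ.len e)))
    {A : Set X} (hA : MeasurableSet A) :
    Γ.edgeDensity e g A = ∫ t in Ioo 0 (Γ.len e) ∩ Γ.param e ⁻¹' A, g t := by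
  have hm := (Γ.continuous_param e).measurable
  rw [edgeDensity, VectorMeasure.map_apply _ hm hA, withDensityᵥ_apply hg (hm hA),
    Measure.restrict_restrict (hm hA), inter_comm]

/-- The parametrization is injective on the open edge, so a point has at most one preimage there, a
null set. -/
theorem edgeDensity_singleton {e : E} {g : ℝ → ℝ} (hg : IntegrableOn g (Ioo 0 (Γ.len e)))
    (p : X) : Γ.edgeDensity e g {p} = 0 := by
  have := Γ.t2
  rw [Γ.edgeDensity_apply hg (measurableSet_singleton p)]
  have h : (Ioo 0 (Γ.len e) ∩ Γ.param e ⁻¹' {p}).Subsingleton := fun s hs t ht =>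
    (Γ.param_interior_unique hs.1 ht.1 (hs.2.trans (Eq.symm ht.2))).2
  exact setIntegral_measure_zero _ (h.measure_zero _)

theorem edgeDensity_image_Ioo [DecidableEq E] {e e' : E} {g : ℝ → ℝ}
    (hg : IntegrableOn g (Ioo 0 (Γ.len e'))) {a b : ℝ} (hab : Ioo a b ⊆ Ioo 0 (Γ.len e))
    (hm : MeasurableSet (Γ.param e '' Ioo a b)) :
    Γ.edgeDensity e' g (Γ.param e '' Ioo a b) = if e' = e then ∫ t in Ioo a b, g t else 0 := by
  rw [Γ.edgeDensity_apply hg hm]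
  have h : ∀ s ∈ Ioo 0 (Γ.len e'), s ∈ Γ.param e' ⁻¹' (Γ.param e '' Ioo a b) →
      e' = e ∧ s ∈ Ioo a b := by
    rintro s hs ⟨t, ht, hst⟩
    obtain ⟨h1, h2⟩ := Γ.param_interior_unique hs (hab ht) hst.symm
    exact ⟨h1, h2 ▸ ht⟩
  split_ifs with hee
  · subst hee
    congr 2
    ext s
    constructor
    · rintro ⟨hs, hs'⟩
      exact (h s hs hs').2
    · intro hs
      exact ⟨hab hs, s, hs, rfl⟩
  · have : Ioo 0 (Γ.len e') ∩ Γ.param e' ⁻¹' (Γ.param e '' Ioo a b) = ∅ := by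
      rw [eq_empty_iff_forall_notMem]
      rintro s ⟨hs, hs'⟩
      exact hee (h s hs hs').1
    rw [this, setIntegral_empty]

theorem measurableSet_image_Ioo {e : E} {a b : ℝ} (hab : Ioo a b ⊆ Ioo 0 (Γ.len e)) :
    MeasurableSet (Γ.param e '' Ioo a b) := by
  have := Γ.t2
  refine measurableSet_Ioo.image_of_continuousOn_injOn (Γ.continuous_param e).continuousOn ?_
  intro s hs t ht h
  exact (Γ.param_interior_unique (hab hs) (hab ht) h).2

variable [Fintype E]

open Classical in
theorem laplacian_singleton {S : Finset X} {f : X → ℝ} (hf : Γ.IsZh S f) (p : X) :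
    Γ.laplacian S f {p} = -(if p ∈ S then Γ.sumDirDeriv f p else 0) := by
  have := Γ.t2
  have h1 : ∀ e, Γ.edgeDensity e (Γ.secondDeriv f e) {p} = 0 := fun e =>
    Γ.edgeDensity_singleton (hf.integrableOn e) p
  simp only [laplacian, _root_.sub_apply, _root_.neg_apply,
    sum_apply, _root_.smul_apply, h1,
    dirac_apply _ (measurableSet_singleton p), mem_singleton_iff, smul_eq_mul, mul_ite, mul_one,
    mul_zero, Finset.sum_const_zero, neg_zero, zero_sub, Finset.sum_ite_eq']

theorem laplacian_image_Ioo {S : Finset X} {f : X → ℝ} (hf : Γ.IsZh S f) {e : E} {a b : ℝ}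
    (hab : Ioo a b ⊆ Ioo 0 (Γ.len e)) (hS : ∀ t ∈ Ioo a b, Γ.param e t ∉ S) :
    Γ.laplacian S f (Γ.param e '' Ioo a b) = -∫ t in Ioo a b, Γ.secondDeriv f e t := by
  classical
  have hm := Γ.measurableSet_image_Ioo hab
  have h1 : ∀ e', Γ.edgeDensity e' (Γ.secondDeriv f e') (Γ.param e '' Ioo a b) =
      if e' = e then ∫ t in Ioo a b, Γ.secondDeriv f e' t else 0 := fun e' =>
    Γ.edgeDensity_image_Ioo (hf.integrableOn e') hab hm
  have h2 : ∀ p ∈ S, (Γ.sumDirDeriv f p • dirac p) (Γ.param e '' Ioo a b) = 0 := by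
    intro p hp
    rw [_root_.smul_apply, dirac_apply _ hm, if_neg, smul_zero]
    rintro ⟨t, ht, rfl⟩
    exact hS t ht hp
  simp only [laplacian, _root_.sub_apply, _root_.neg_apply,
    sum_apply, h1, Finset.sum_congr rfl h2,
    Finset.sum_const_zero, sub_zero, Finset.sum_ite_eq', Finset.mem_univ, if_true]

end MetrizedGraph

namespace MetrizedGraph

variable {X E : Type*} [TopologicalSpace X] (Γ : MetrizedGraph X E) [MeasurableSpace X]
  [BorelSpace X] [Fintype E]

/-! ### Uniqueness of the voltage function -/

section Uniqueness

variable {Γ} {S : Finset X} {f : X → ℝ} {y z : X}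

/-- The Laplacian has no atoms outside S, so S must contain both poles unless they cancel. -/
theorem eq_or_mem_of_laplacian_eq (hf : Γ.IsZh S f) (hΔ : Γ.laplacian S f = dirac y - dirac z) :
    y = z ∨ (y ∈ S ∧ z ∈ S) := by
  classical
  have := Γ.t2
  by_cases hyz : y = z
  · exact Or.inl hyz
  refine Or.inr ⟨?_, ?_⟩
  · by_contra h
    have h1 := Γ.laplacian_singleton hf y
    rw [hΔ, _root_.sub_apply, dirac_apply _ (measurableSet_singleton y),
      dirac_apply _ (measurableSet_singleton y)] at h1
    simp [h, Ne.symm hyz] at h1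
  · by_contra h
    have h1 := Γ.laplacian_singleton hf z
    rw [hΔ, _root_.sub_apply, dirac_apply _ (measurableSet_singleton z),
      dirac_apply _ (measurableSet_singleton z)] at h1
    simp [h, hyz] at h1

omit [MeasurableSpace X] [BorelSpace X] [Fintype E] in
theorem isOpen_edge_sdiff (S : Finset X) (e : E) :
    IsOpen {t | t ∈ Ioo 0 (Γ.len e) ∧ Γ.param e t ∉ S} := by
  have := Γ.t2
  exact isOpen_Ioo.inter
    (S.finite_toSet.isClosed.isOpen_compl.preimage (Γ.continuous_param e))

/-- The Laplacian of an open interval avoiding S is minus the integral of f'' and is also 0, so the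
fundamental theorem of calculus equates the end slopes. Hence f is affine between points of S. -/
theorem deriv_eq_of_laplacian_eq (hf : Γ.IsZh S f)
    (hΔ : Γ.laplacian S f = dirac y - dirac z) {e : E} {a b : ℝ} (hab : a < b)
    (hS : Icc a b ⊆ {t | t ∈ Ioo 0 (Γ.len e) ∧ Γ.param e t ∉ S}) :
    deriv (fun t => f (Γ.param e t)) a = deriv (fun t => f (Γ.param e t)) b := by
  classical
  have hI : Ioo a b ⊆ Ioo 0 (Γ.len e) := fun t ht => (hS (Ioo_subset_Icc_self ht)).1
  have hm := Γ.measurableSet_image_Ioo hI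
  have h1 := Γ.laplacian_image_Ioo hf hI fun t ht => (hS (Ioo_subset_Icc_self ht)).2
  have h2 : Γ.laplacian S f (Γ.param e '' Ioo a b) = 0 := by
    have hn : ∀ x ∈ S, x ∉ Γ.param e '' Ioo a b := by
      rintro _ hx ⟨t, ht, rfl⟩
      exact (hS (Ioo_subset_Icc_self ht)).2 hx
    rw [hΔ, _root_.sub_apply, dirac_apply _ hm, dirac_apply _ hm]
    rcases eq_or_mem_of_laplacian_eq hf hΔ with h | ⟨hy, hz⟩
    · rw [h, sub_self]
    · rw [if_neg (hn y hy), if_neg (hn z hz), sub_self]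
  rw [h2, zero_eq_neg, ← integral_Ioc_eq_integral_Ioo,
    ← intervalIntegral.integral_of_le hab.le] at h1
  have hd : ∀ t ∈ uIcc a b, HasDerivAt (deriv fun t => f (Γ.param e t))
      (Γ.secondDeriv f e t) t := by
    intro t ht
    rw [uIcc_of_le hab.le] at ht
    have hU := isOpen_edge_sdiff (Γ := Γ) S e
    have hc := (hf.contDiffOn e).deriv_of_isOpen hU (m := 1) (by norm_num)
    exact ((hc.differentiableOn one_ne_zero).differentiableAt
      (hU.mem_nhds (hS ht))).hasDerivAt
  have h3 := intervalIntegral.integral_eq_sub_of_hasDerivAt hd ?_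
  · rw [h1] at h3; linarith
  · rw [intervalIntegrable_iff_integrableOn_Ioo_of_le hab.le]
    exact (hf.integrableOn e).mono_set hI

theorem affine_of_laplacian_eq (hf : Γ.IsZh S f)
    (hΔ : Γ.laplacian S f = dirac y - dirac z) {e : E} {a b : ℝ} (hab : a < b)
    (hS : Ioo a b ⊆ {t | t ∈ Ioo 0 (Γ.len e) ∧ Γ.param e t ∉ S}) :
    ∃ c, ∀ s ∈ Icc a b, ∀ t ∈ Icc a b,
      f (Γ.param e t) = f (Γ.param e s) + c * (t - s) := by
  have hmid : (a + b) / 2 ∈ Ioo a b := ⟨by linarith, by linarith⟩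
  refine ⟨deriv (fun t => f (Γ.param e t)) ((a + b) / 2), fun s hs t ht =>
    affine_of_hasDerivAt_const (φ := fun t => f (Γ.param e t))
      (hf.continuous.comp (Γ.continuous_param e)).continuousOn (fun x hx => ?_) hs ht⟩
  have hd : DifferentiableAt ℝ (fun t => f (Γ.param e t)) x :=
    ((hf.contDiffOn e).differentiableOn two_ne_zero).differentiableAt
      ((isOpen_edge_sdiff S e).mem_nhds (hS hx))
  have heq : deriv (fun t => f (Γ.param e t)) x =
      deriv (fun t => f (Γ.param e t)) ((a + b) / 2) := by
    rcases lt_trichotomy x ((a + b) / 2) with h | h | h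
    · exact deriv_eq_of_laplacian_eq hf hΔ h
        (subset_trans (Icc_subset_Ioo hx.1 hmid.2) hS)
    · rw [h]
    · exact (deriv_eq_of_laplacian_eq hf hΔ h
        (subset_trans (Icc_subset_Ioo hmid.1 hx.2) hS)).symm
  rw [← heq]
  exact hd.hasDerivAt

omit [MeasurableSpace X] [BorelSpace X] [Fintype E] in
theorem eventually_param_not_mem (S : Finset X) (e : E) (t : ℝ) :
    ∀ᶠ s in 𝓝[≠] t, s ∈ Ioo 0 (Γ.len e) → Γ.param e s ∉ S := by
  have hfin : {s | s ∈ Ioo 0 (Γ.len e) ∧ Γ.param e s ∈ S}.Finite := by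
    refine Set.Finite.of_finite_image (f := Γ.param e) (S.finite_toSet.subset ?_) ?_
    · rintro _ ⟨s, hs, rfl⟩
      exact hs.2
    · intro s hs s' hs' h
      exact (Γ.param_interior_unique hs.1 hs'.1 h).2
  have h2 : ∀ᶠ s in 𝓝[≠] t, s ∉ {s | s ∈ Ioo 0 (Γ.len e) ∧ Γ.param e s ∈ S} := by
    have h3 : IsOpen ({s | s ∈ Ioo 0 (Γ.len e) ∧ Γ.param e s ∈ S} \ {t})ᶜ :=
      (hfin.subset sdiff_subset).isClosed.isOpen_compl
    have h4 : ∀ᶠ s in 𝓝 t, s ∈ ({s | s ∈ Ioo 0 (Γ.len e) ∧ Γ.param e s ∈ S} \ {t})ᶜ :=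
      h3.mem_nhds fun hm => hm.2 rfl
    filter_upwards [nhdsWithin_le_nhds h4, self_mem_nhdsWithin] with s hs hne hm
    exact hs ⟨hm, hne⟩
  filter_upwards [h2] with s hs h1 h2 using hs ⟨h1, h2⟩

theorem eventually_affine_right_of_laplacian_eq (hf : Γ.IsZh S f)
    (hΔ : Γ.laplacian S f = dirac y - dirac z) {e : E} {t : ℝ} (ht : t ∈ Ico 0 (Γ.len e)) :
    ∃ c, ∀ᶠ s in 𝓝[>] t, f (Γ.param e s) = f (Γ.param e t) + c * (s - t) := by
  have h : ∀ᶠ s in 𝓝[>] t, s ∈ {s | s ∈ Ioo 0 (Γ.len e) ∧ Γ.param e s ∉ S} := by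
    filter_upwards [nhdsGT_le_nhdsNE t (eventually_param_not_mem (Γ := Γ) S e t),
      Ioo_mem_nhdsGT ht.2] with s hs hs'
    have : s ∈ Ioo 0 (Γ.len e) := ⟨ht.1.trans_lt hs'.1, hs'.2⟩
    exact ⟨this, hs this⟩
  obtain ⟨u, hu, hus⟩ := mem_nhdsGT_iff_exists_Ioo_subset.1 h
  obtain ⟨c, hc⟩ := affine_of_laplacian_eq hf hΔ hu hus
  refine ⟨c, ?_⟩
  filter_upwards [Ioo_mem_nhdsGT hu] with s hs
  exact hc t (left_mem_Icc.2 (le_of_lt hu)) s (Ioo_subset_Icc_self hs)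

theorem eventually_affine_left_of_laplacian_eq (hf : Γ.IsZh S f)
    (hΔ : Γ.laplacian S f = dirac y - dirac z) {e : E} {t : ℝ} (ht : t ∈ Ioc 0 (Γ.len e)) :
    ∃ c, ∀ᶠ s in 𝓝[<] t, f (Γ.param e s) = f (Γ.param e t) + c * (s - t) := by
  have h : ∀ᶠ s in 𝓝[<] t, s ∈ {s | s ∈ Ioo 0 (Γ.len e) ∧ Γ.param e s ∉ S} := by
    filter_upwards [nhdsLT_le_nhdsNE t (eventually_param_not_mem (Γ := Γ) S e t),
      Ioo_mem_nhdsLT ht.1] with s hs hs'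
    have : s ∈ Ioo 0 (Γ.len e) := ⟨hs'.1, hs'.2.trans_le ht.2⟩
    exact ⟨this, hs this⟩
  obtain ⟨u, hu, hus⟩ := mem_nhdsLT_iff_exists_Ioo_subset.1 h
  obtain ⟨c, hc⟩ := affine_of_laplacian_eq hf hΔ hu hus
  refine ⟨c, ?_⟩
  filter_upwards [Ioo_mem_nhdsLT hu] with s hs
  exact hc t (right_mem_Icc.2 (le_of_lt hu)) s (Ioo_subset_Icc_self hs)

open Classical in
-- At points outside S the two one-sided slopes cancel by differentiability. The result does not
-- depend on S, so voltages defined with different sets S can be compared.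
theorem sumDirDeriv_of_laplacian_eq (hV : Γ.vertices ⊆ S) (hf : Γ.IsZh S f)
    (hΔ : Γ.laplacian S f = dirac y - dirac z) (p : X) :
    Γ.sumDirDeriv f p = (if z = p then 1 else 0) - if y = p then 1 else 0 := by
  have := Γ.t2
  have h1 := Γ.laplacian_singleton hf p
  rw [hΔ, _root_.sub_apply, dirac_apply _ (measurableSet_singleton p),
    dirac_apply _ (measurableSet_singleton p)] at h1
  simp only [mem_singleton_iff] at h1
  by_cases hp : p ∈ S
  · rw [if_pos hp] at h1
    linarith
  · have h0 : Γ.sumDirDeriv f p = 0 := by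
      rcases Γ.cover p with hv | ⟨e, t, ht, rfl⟩
      · exact absurd (hV hv) hp
      · have hd : DifferentiableAt ℝ (fun t => f (Γ.param e t)) t :=
          ((hf.contDiffOn e).differentiableOn two_ne_zero).differentiableAt
            ((isOpen_edge_sdiff S e).mem_nhds ⟨ht, hp⟩)
        rw [Γ.sumDirDeriv_interior f ht,
          hd.hasDerivAt.hasDerivWithinAt.derivWithin (uniqueDiffWithinAt_Ioi t),
          hd.hasDerivAt.hasDerivWithinAt.derivWithin (uniqueDiffWithinAt_Iio t), sub_self]
    rw [if_neg hp] at h1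
    linarith

/-- Two voltages have the same kinks, so their difference is affine on whole edges and its vertex
values are harmonic for L, hence constant. The normalization at z makes the constant 0. -/
theorem IsVoltage.unique {f g : X → ℝ} (hf : Γ.IsVoltage z y f) (hg : Γ.IsVoltage z y g) :
    f = g := by
  classical
  obtain ⟨hf0, S, hVS, hfS, hfΔ⟩ := hf
  obtain ⟨hg0, T, hVT, hgT, hgΔ⟩ := hg
  have hsum : ∀ p, Γ.sumDirDeriv f p = Γ.sumDirDeriv g p := fun p => by
    rw [sumDirDeriv_of_laplacian_eq hVS hfS hfΔ, sumDirDeriv_of_laplacian_eq hVT hgT hgΔ]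
  have hcont : ∀ e, Continuous fun t => f (Γ.param e t) - g (Γ.param e t) := fun e =>
    (hfS.continuous.comp (Γ.continuous_param e)).sub (hgT.continuous.comp (Γ.continuous_param e))
  have hloc : ∀ e, ∀ t ∈ Ioo 0 (Γ.len e), ∃ c, ∀ᶠ s in 𝓝 t,
      f (Γ.param e s) - g (Γ.param e s) = f (Γ.param e t) - g (Γ.param e t) + c * (s - t) := by
    intro e t ht
    obtain ⟨a, ha⟩ := eventually_affine_right_of_laplacian_eq hfS hfΔ (Ioo_subset_Ico_self ht)
    obtain ⟨b, hb⟩ := eventually_affine_left_of_laplacian_eq hfS hfΔ (Ioo_subset_Ioc_self ht)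
    obtain ⟨a', ha'⟩ := eventually_affine_right_of_laplacian_eq hgT hgΔ (Ioo_subset_Ico_self ht)
    obtain ⟨b', hb'⟩ := eventually_affine_left_of_laplacian_eq hgT hgΔ (Ioo_subset_Ioc_self ht)
    have h := hsum (Γ.param e t)
    rw [Γ.sumDirDeriv_interior f ht, Γ.sumDirDeriv_interior g ht,
      derivWithin_Ioi_of_eventually_affine (φ := fun s => f (Γ.param e s)) ha,
      derivWithin_Iio_of_eventually_affine (φ := fun s => f (Γ.param e s)) hb,
      derivWithin_Ioi_of_eventually_affine (φ := fun s => g (Γ.param e s)) ha',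
      derivWithin_Iio_of_eventually_affine (φ := fun s => g (Γ.param e s)) hb'] at h
    -- Equal jumps of slope for f and g mean that f - g has equal left and right slopes at t.
    have hba : b - b' = a - a' := by linarith
    refine ⟨a - a', eventually_affine_nhds
      (φ := fun s => f (Γ.param e s) - g (Γ.param e s)) ?_ ?_⟩
    · rw [← hba]
      filter_upwards [hb, hb'] with s hs hs'
      rw [hs, hs']; ring
    · filter_upwards [ha, ha'] with s hs hs'
      rw [hs, hs']; ring
  have haff : ∀ e, ∃ c, ∀ s ∈ Icc 0 (Γ.len e), ∀ t ∈ Icc 0 (Γ.len e),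
      f (Γ.param e t) - g (Γ.param e t) = f (Γ.param e s) - g (Γ.param e s) + c * (t - s) := by
    intro e
    have hd : ∀ t ∈ Ioo 0 (Γ.len e),
        HasDerivAt (deriv fun t => f (Γ.param e t) - g (Γ.param e t)) 0 t := by
      intro t ht
      obtain ⟨c, hc⟩ := hloc e t ht
      exact (hasDerivAt_const t c).congr_of_eventuallyEq (deriv_eventuallyEq_of_eventually_affine
        (φ := fun t => f (Γ.param e t) - g (Γ.param e t)) hc)
    obtain ⟨c, hc⟩ := isOpen_Ioo.exists_is_const_of_deriv_eq_zero isPreconnected_Ioo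
      (fun t ht => (hd t ht).differentiableAt.differentiableWithinAt) fun t ht => (hd t ht).deriv
    refine ⟨c, fun s hs t ht => affine_of_hasDerivAt_const
      (φ := fun t => f (Γ.param e t) - g (Γ.param e t)) (hcont e).continuousOn ?_ hs ht⟩
    intro x hx
    obtain ⟨c', hc'⟩ := hloc e x hx
    have hdx := hasDerivWithinAt_of_eventually_affine (s := univ)
      (φ := fun t => f (Γ.param e t) - g (Γ.param e t)) (by rwa [nhdsWithin_univ])
    rw [hasDerivWithinAt_univ] at hdx
    rw [← hc x hx]
    exact hdx.differentiableAt.hasDerivAt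
  set u : Γ.vertices → ℝ := fun p => f p - g p with hu
  choose c hc using haff
  have hcu : ∀ e, c e = (u (Γ.tgt e) - u (Γ.src e)) / Γ.len e := by
    intro e
    have hL := Γ.len_pos e
    have h := hc e 0 (left_mem_Icc.2 hL.le) (Γ.len e) (right_mem_Icc.2 hL.le)
    rw [eq_div_iff hL.ne']
    simp only [hu, src, tgt]
    linarith
  have hsrc : ∀ e, derivWithin (fun s => f (Γ.param e s)) (Ioi 0) 0 -
      derivWithin (fun s => g (Γ.param e s)) (Ioi 0) 0 = c e := by
    intro e
    have hL := Γ.len_pos e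
    obtain ⟨a, ha⟩ := eventually_affine_right_of_laplacian_eq hfS hfΔ (left_mem_Ico.2 hL)
    obtain ⟨a', ha'⟩ := eventually_affine_right_of_laplacian_eq hgT hgΔ (left_mem_Ico.2 hL)
    rw [derivWithin_Ioi_of_eventually_affine (φ := fun s => f (Γ.param e s)) ha,
      derivWithin_Ioi_of_eventually_affine (φ := fun s => g (Γ.param e s)) ha']
    -- A single nearby point s, where the local and the global affine formulas both hold, identifies
    -- the one-sided slope with c e.
    obtain ⟨s, hs, hs', hI⟩ := (ha.and (ha'.and (Ioo_mem_nhdsGT hL))).exists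
    have h := hc e 0 (left_mem_Icc.2 hL.le) s (Ioo_subset_Icc_self hI)
    have h' : (a - a' - c e) * s = 0 := by linarith
    have := (mul_eq_zero.1 h').resolve_right hI.1.ne'
    linarith
  have htgt : ∀ e, derivWithin (fun s => f (Γ.param e s)) (Iio (Γ.len e)) (Γ.len e) -
      derivWithin (fun s => g (Γ.param e s)) (Iio (Γ.len e)) (Γ.len e) = c e := by
    intro e
    have hL := Γ.len_pos e
    obtain ⟨a, ha⟩ := eventually_affine_left_of_laplacian_eq hfS hfΔ (right_mem_Ioc.2 hL)
    obtain ⟨a', ha'⟩ := eventually_affine_left_of_laplacian_eq hgT hgΔ (right_mem_Ioc.2 hL)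
    rw [derivWithin_Iio_of_eventually_affine (φ := fun s => f (Γ.param e s)) ha,
      derivWithin_Iio_of_eventually_affine (φ := fun s => g (Γ.param e s)) ha']
    obtain ⟨s, hs, hs', hI⟩ := (ha.and (ha'.and (Ioo_mem_nhdsLT hL))).exists
    have h := hc e (Γ.len e) (right_mem_Icc.2 hL.le) s (Ioo_subset_Icc_self hI)
    have h' : (a - a' - c e) * (s - Γ.len e) = 0 := by linarith
    have := (mul_eq_zero.1 h').resolve_right (sub_neg.2 hI.2).ne
    linarith
  have hLu : Γ.laplacianMatrix *ᵥ u = 0 := by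
    funext p
    have h := sub_eq_zero.2 (hsum p)
    rw [Γ.sumDirDeriv_vertex, Γ.sumDirDeriv_vertex, ← Finset.sum_sub_distrib] at h
    rw [laplacianMatrix_mulVec_apply, Pi.zero_apply, ← neg_eq_zero, ← h, ← Finset.sum_neg_distrib]
    refine Finset.sum_congr rfl fun e _ => ?_
    have h1 := hsrc e
    have h2 := htgt e
    rw [hcu] at h1 h2
    have h3 : (u (Γ.src e) - u (Γ.tgt e)) / Γ.len e = -((u (Γ.tgt e) - u (Γ.src e)) / Γ.len e) := by
      ring
    rw [h3]
    split_ifs <;> linarith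
  have hc0 : ∀ e, c e = 0 := fun e => by
    rw [hcu, Γ.eq_of_laplacianMatrix_mulVec_eq_zero hLu e, sub_self, zero_div]
  obtain ⟨p₀, hp₀⟩ := Γ.vertices_nonempty
  have hconst : ∀ x, f x - g x = u ⟨p₀, hp₀⟩ := by
    intro x
    rcases Γ.cover x with hx | ⟨e, t, ht, rfl⟩
    · exact Γ.const_of_laplacianMatrix_mulVec_eq_zero hLu ⟨x, hx⟩ _
    · rw [hc e 0 (left_mem_Icc.2 (Γ.len_pos e).le) t (Ioo_subset_Icc_self ht), hc0, zero_mul,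
        add_zero]
      exact Γ.const_of_laplacianMatrix_mulVec_eq_zero hLu (Γ.src e) _
  funext x
  have h1 := hconst z
  have h2 := hconst x
  linarith

end Uniqueness

/-! ### Existence of the voltage function -/

/-- The Green function with base point `z`. -/
noncomputable def basedGreen (z x y : X) : ℝ :=
  Γ.green x y - Γ.green x z - Γ.green z y + Γ.green z z

/-- The slope of the affine part, along the edge `e`, of the based Green function. -/
noncomputable def basedGreenSlope (z y : X) (e : E) : ℝ :=
  ((Γ.laplacianPinv *ᵥ (Γ.weight y - Γ.weight z)) (Γ.tgt e) -
    (Γ.laplacianPinv *ᵥ (Γ.weight y - Γ.weight z)) (Γ.src e)) / Γ.len e -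
      Γ.coord e y / Γ.len e + Γ.coord e z / Γ.len e

omit [MeasurableSpace X] [BorelSpace X] in
theorem basedGreen_param (z y : X) (e : E) {s t : ℝ} (hs : s ∈ Icc 0 (Γ.len e))
    (ht : t ∈ Icc 0 (Γ.len e)) :
    Γ.basedGreen z (Γ.param e t) y - Γ.basedGreen z (Γ.param e s) y =
      Γ.basedGreenSlope z y e * (t - s) + (min t (Γ.coord e y) - min s (Γ.coord e y)) -
        (min t (Γ.coord e z) - min s (Γ.coord e z)) := by
  simp only [basedGreen, basedGreenSlope, green, Γ.localGreen_param hs, Γ.localGreen_param ht,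
    Γ.interp_param _ hs, Γ.interp_param _ ht, Matrix.mulVec_sub, Pi.sub_apply]
  ring

omit [MeasurableSpace X] [BorelSpace X] in
theorem eventually_basedGreen_right (z y : X) {e : E} {t : ℝ} (ht : t ∈ Ico 0 (Γ.len e)) :
    ∀ᶠ s in 𝓝[>] t, Γ.basedGreen z (Γ.param e s) y = Γ.basedGreen z (Γ.param e t) y +
      (Γ.basedGreenSlope z y e + (if t < Γ.coord e y then 1 else 0) -
        if t < Γ.coord e z then 1 else 0) * (s - t) := by
  filter_upwards [eventually_min_right t (Γ.coord e y), eventually_min_right t (Γ.coord e z),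
    Ioo_mem_nhdsGT ht.2] with s h1 h2 h3
  have h := Γ.basedGreen_param z y e (Ico_subset_Icc_self ht)
    (t := s) ⟨ht.1.trans h3.1.le, h3.2.le⟩
  rw [h1, h2] at h
  linarith

omit [MeasurableSpace X] [BorelSpace X] in
theorem eventually_basedGreen_left (z y : X) {e : E} {t : ℝ} (ht : t ∈ Ioc 0 (Γ.len e)) :
    ∀ᶠ s in 𝓝[<] t, Γ.basedGreen z (Γ.param e s) y = Γ.basedGreen z (Γ.param e t) y +
      (Γ.basedGreenSlope z y e + (if t ≤ Γ.coord e y then 1 else 0) -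
        if t ≤ Γ.coord e z then 1 else 0) * (s - t) := by
  filter_upwards [eventually_min_left t (Γ.coord e y), eventually_min_left t (Γ.coord e z),
    Ioo_mem_nhdsLT ht.1] with s h1 h2 h3
  have h := Γ.basedGreen_param z y e (Ioc_subset_Icc_self ht)
    (t := s) ⟨h3.1.le, h3.2.le.trans ht.2⟩
  rw [h1, h2] at h
  linarith

omit [MeasurableSpace X] [BorelSpace X] [Fintype E] in
theorem coord_eq_iff {e : E} {t : ℝ} (ht : t ∈ Ioo 0 (Γ.len e)) (y : X) :
    t = Γ.coord e y ↔ y = Γ.param e t := by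
  constructor
  · rintro rfl
    exact (Γ.param_coord ht.1).symm
  · rintro rfl
    exact (Γ.coord_param ht).symm

omit [MeasurableSpace X] [BorelSpace X] in
open Classical in
-- At an interior point only the kinks of `min` contribute. At a vertex, the affine part gives -L L⁺
-- (w(y) - w(z)), which is -(w(y) - w(z)), and the edge terms restore all of w(y) - w(z) except its
-- Dirac part.
theorem sumDirDeriv_basedGreen (z y p : X) :
    Γ.sumDirDeriv (fun x => Γ.basedGreen z x y) p =
      (if z = p then 1 else 0) - if y = p then 1 else 0 := by
  rcases Γ.cover p with hp | ⟨e, t, ht, rfl⟩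
  · obtain ⟨p, rfl⟩ : ∃ q : Γ.vertices, (q : X) = p := ⟨⟨p, hp⟩, rfl⟩
    set v := Γ.laplacianPinv *ᵥ (Γ.weight y - Γ.weight z) with hv
    have h1 := Γ.laplacianMatrix_mulVec_laplacianPinv_mulVec (Γ.weight y - Γ.weight z) p
    -- Both weight vectors sum to 1, so the mean subtracted by the projection L L⁺ vanishes.
    simp only [Pi.sub_apply, Finset.sum_sub_distrib, Γ.sum_weight, sub_self, zero_div,
      sub_zero] at h1
    rw [← hv, laplacianMatrix_mulVec_apply, weight, weight] at h1
    rw [Γ.sumDirDeriv_vertex]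
    have h2 : ∀ e, ((if Γ.src e = p then
          derivWithin (fun s => Γ.basedGreen z (Γ.param e s) y) (Ioi 0) 0 else 0) -
        if Γ.tgt e = p then
          derivWithin (fun s => Γ.basedGreen z (Γ.param e s) y) (Iio (Γ.len e)) (Γ.len e)
          else 0) =
        (if 0 < Γ.coord e y then
          (if Γ.src e = p then 1 - Γ.coord e y / Γ.len e else 0) +
            (if Γ.tgt e = p then Γ.coord e y / Γ.len e else 0) else 0) -
        (if 0 < Γ.coord e z then
          (if Γ.src e = p then 1 - Γ.coord e z / Γ.len e else 0) +
            (if Γ.tgt e = p then Γ.coord e z / Γ.len e else 0) else 0) -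
        ((if Γ.src e = p then (v (Γ.src e) - v (Γ.tgt e)) / Γ.len e else 0) +
          if Γ.tgt e = p then (v (Γ.tgt e) - v (Γ.src e)) / Γ.len e else 0) := by
      intro e
      have hL := Γ.len_pos e
      have hy := Γ.coord_mem e y
      have hz := Γ.coord_mem e z
      rw [derivWithin_Ioi_of_eventually_affine (φ := fun s => Γ.basedGreen z (Γ.param e s) y)
          (Γ.eventually_basedGreen_right z y (left_mem_Ico.2 hL)),
        derivWithin_Iio_of_eventually_affine (φ := fun s => Γ.basedGreen z (Γ.param e s) y)
          (Γ.eventually_basedGreen_left z y (right_mem_Ioc.2 hL)),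
        if_neg (not_le.2 hy.2), if_neg (not_le.2 hz.2), basedGreenSlope, ← hv]
      -- A coordinate that is not positive is the default value 0, so a pole off the open edge
      -- contributes nothing to either side.
      have key : ∀ a : ℝ, 0 ≤ a → ¬ 0 < a → a = 0 := fun a h h' => le_antisymm (not_lt.1 h') h
      by_cases hy0 : 0 < Γ.coord e y <;> by_cases hz0 : 0 < Γ.coord e z <;>
      simp only [hy0, hz0, if_true, if_false] <;>
      [skip; rw [key _ hz.1 hz0]; rw [key _ hy.1 hy0]; rw [key _ hz.1 hz0, key _ hy.1 hy0]] <;>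
      split_ifs <;> ring
    rw [Finset.sum_congr rfl fun e _ => h2 e, Finset.sum_sub_distrib, h1, Finset.sum_sub_distrib]
    rw [eq_comm (a := z), eq_comm (a := y)]
    ring
  · rw [Γ.sumDirDeriv_interior _ ht,
      derivWithin_Ioi_of_eventually_affine (φ := fun s => Γ.basedGreen z (Γ.param e s) y)
        (Γ.eventually_basedGreen_right z y (Ioo_subset_Ico_self ht)),
      derivWithin_Iio_of_eventually_affine (φ := fun s => Γ.basedGreen z (Γ.param e s) y)
        (Γ.eventually_basedGreen_left z y (Ioo_subset_Ioc_self ht))]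
    simp only [← Γ.coord_eq_iff ht, le_iff_lt_or_eq]
    have key : ∀ a : ℝ, (if t < a ∨ t = a then (1 : ℝ) else 0) =
        (if t < a then 1 else 0) + if t = a then 1 else 0 := by
      intro a
      by_cases h1 : t < a
      · simp [h1, h1.ne]
      · simp [h1]
    rw [key, key]
    ring

omit [MeasurableSpace X] [BorelSpace X] in
theorem eventually_basedGreen_nhds (z y : X) {e : E} {t : ℝ} (ht : t ∈ Ioo 0 (Γ.len e))
    (hy : y ≠ Γ.param e t) (hz : z ≠ Γ.param e t) :
    ∃ c, ∀ᶠ s in 𝓝 t, Γ.basedGreen z (Γ.param e s) y =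
      Γ.basedGreen z (Γ.param e t) y + c * (s - t) := by
  have hl := Γ.eventually_basedGreen_left z y (Ioo_subset_Ioc_self ht)
  have hr := Γ.eventually_basedGreen_right z y (Ioo_subset_Ico_self ht)
  rw [ne_eq, ← Γ.coord_eq_iff ht] at hy hz
  simp only [le_iff_lt_or_eq, hy, hz, or_false] at hl
  exact ⟨_, eventually_affine_nhds (φ := fun s => Γ.basedGreen z (Γ.param e s) y) hl hr⟩

omit [MeasurableSpace X] [BorelSpace X] in
theorem secondDeriv_basedGreen (z y : X) (e : E) :
    Γ.secondDeriv (fun x => Γ.basedGreen z x y) e =ᵐ[volume.restrict (Ioo 0 (Γ.len e))] 0 := by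
  have h : ∀ᵐ t : ℝ, t ∉ ({Γ.coord e y, Γ.coord e z} : Set ℝ) :=
    measure_eq_zero_iff_ae_notMem.1 (((finite_singleton _).insert _).measure_zero _)
  rw [EventuallyEq, ae_restrict_iff' measurableSet_Ioo]
  filter_upwards [h] with t ht hI
  simp only [mem_insert_iff, mem_singleton_iff, not_or] at ht
  obtain ⟨c, hc⟩ := Γ.eventually_basedGreen_nhds z y hI
    ((Γ.coord_eq_iff hI y).not.1 ht.1) ((Γ.coord_eq_iff hI z).not.1 ht.2)
  have h1 := deriv_eventuallyEq_of_eventually_affine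
    (φ := fun s => Γ.basedGreen z (Γ.param e s) y) hc
  rw [secondDeriv, h1.deriv_eq, deriv_const, Pi.zero_apply]

omit [BorelSpace X] in
theorem isVoltage_basedGreen (z y : X) : Γ.IsVoltage z y fun x => Γ.basedGreen z x y := by
  classical
  refine ⟨by simp [basedGreen], Γ.vertices ∪ {y, z}, Finset.subset_union_left, ⟨?_, ?_, ?_⟩, ?_⟩
  · exact (((Γ.continuous_green_left y).sub (Γ.continuous_green_left z)).sub
      continuous_const).add continuous_const
  · rintro e t ⟨ht, hS⟩
    simp only [Finset.mem_union, Finset.mem_insert, Finset.mem_singleton, not_or] at hS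
    obtain ⟨c, hc⟩ := Γ.eventually_basedGreen_nhds z y ht (Ne.symm hS.2.1) (Ne.symm hS.2.2)
    refine ContDiffAt.contDiffWithinAt (ContDiffAt.congr_of_eventuallyEq ?_ hc)
    fun_prop
  · intro e
    exact (integrable_zero ℝ ℝ _).congr (Γ.secondDeriv_basedGreen z y e).symm
  · have h1 : ∀ e, Γ.edgeDensity e (Γ.secondDeriv (fun x => Γ.basedGreen z x y) e) = 0 := fun e =>
      Γ.edgeDensity_eq_zero (Γ.secondDeriv_basedGreen z y e)
    simp only [laplacian, h1, Finset.sum_const_zero, neg_zero, zero_sub, sumDirDeriv_basedGreen]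
    refine VectorMeasure.ext fun A _ => ?_
    simp only [_root_.neg_apply, sum_apply, _root_.smul_apply, _root_.sub_apply, smul_eq_mul,
      sub_mul, ite_mul, one_mul, zero_mul, Finset.sum_sub_distrib, Finset.sum_ite_eq]
    rw [if_pos (by simp), if_pos (by simp), neg_sub]

theorem voltage_eq_basedGreen (z x y : X) : Γ.voltage z x y = Γ.basedGreen z x y :=
  congrFun (IsVoltage.unique (Classical.epsilon_spec ⟨_, Γ.isVoltage_basedGreen z y⟩)
    (Γ.isVoltage_basedGreen z y)) x

theorem voltage_self (z x : X) :
    Γ.voltage z x x = Γ.green x x + Γ.green z z - 2 * Γ.green x z := by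
  rw [voltage_eq_basedGreen, basedGreen, Γ.green_comm z x]
  ring

end MetrizedGraph

/-! ### Integration with respect to signed measures -/

namespace MeasureTheory.SignedMeasure

variable {α : Type*} [MeasurableSpace α]

instance isFiniteMeasure_variation (μ : SignedMeasure α) : IsFiniteMeasure μ.variation := by
  rw [← totalVariation_eq_variation, totalVariation]
  infer_instance

theorem integrable_of_bound (μ : SignedMeasure α) {f : α → ℝ} (hf : Measurable f) {C : ℝ}
    (hC : ∀ x, |f x| ≤ C) : μ.Integrable f :=
  Integrable.of_bound hf.aestronglyMeasurable C (Eventually.of_forall hC)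

theorem integrable_of_continuous [TopologicalSpace α] [CompactSpace α] [OpensMeasurableSpace α]
    (μ : SignedMeasure α) {f : α → ℝ} (hf : Continuous f) : μ.Integrable f := by
  obtain ⟨C, hC⟩ := isCompact_univ.exists_bound_of_continuousOn hf.continuousOn
  exact μ.integrable_of_bound hf.measurable fun x => hC x (mem_univ x)

/-- Reconciles the two orders of the scalar pairing, which coincide since multiplication is
commutative. -/
theorem lsmul_flip_real :
    (ContinuousLinearMap.lsmul ℝ ℝ : ℝ →L[ℝ] ℝ →L[ℝ] ℝ).flip = ContinuousLinearMap.lsmul ℝ ℝ := by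
  ext
  simp

theorem integral_measure_toSignedMeasure {m : Measure α} [IsFiniteMeasure m] (f : α → ℝ) :
    ∫ᵛ x, f x ∂•m.toSignedMeasure = ∫ x, f x ∂m := by
  rw [← VectorMeasure.integral_toSignedMeasure, lsmul_flip_real]

theorem integral_one (μ : SignedMeasure α) : ∫ᵛ _, (1 : ℝ) ∂•μ = μ univ := by
  rw [VectorMeasure.integral_const]
  simp

theorem integral_indicator_one (μ : SignedMeasure α) {s : Set α} (hs : MeasurableSet s) :
    ∫ᵛ x, s.indicator (fun _ => (1 : ℝ)) x ∂•μ = μ s := by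
  rw [VectorMeasure.integral_indicator_const _ hs]
  simp

end MeasureTheory.SignedMeasure

theorem integral_min_const {L c : ℝ} (hc : 0 ≤ c) (hcL : c ≤ L) :
    ∫ t in (0 : ℝ)..L, min t c = c ^ 2 / 2 + c * (L - c) := by
  have hi : ∀ a b : ℝ, IntervalIntegrable (fun t => min t c) volume a b := fun a b =>
    Continuous.intervalIntegrable (by fun_prop) a b
  rw [← intervalIntegral.integral_add_adjacent_intervals (hi 0 c) (hi c L)]
  congr 1
  · rw [intervalIntegral.integral_congr (g := fun t => t), integral_id]
    · ring
    · intro t ht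
      rw [uIcc_of_le hc] at ht
      exact min_eq_left ht.2
  · rw [intervalIntegral.integral_congr (g := fun _ => c), intervalIntegral.integral_const,
      smul_eq_mul]
    · ring
    · intro t ht
      rw [uIcc_of_le hcL] at ht
      exact min_eq_right ht.1

/-! ### Integrals against Dirac and arc length measures -/

namespace MetrizedGraph

variable {X E : Type*} [TopologicalSpace X] (Γ : MetrizedGraph X E) [MeasurableSpace X]
  [BorelSpace X]

theorem integral_dirac {X : Type*} [MeasurableSpace X] (p : X) {f : X → ℝ} (hf : Measurable f) :
    ∫ᵛ x, f x ∂•dirac p = f p := by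
  rw [dirac, SignedMeasure.integral_measure_toSignedMeasure,
    MeasureTheory.integral_dirac' _ _ hf.stronglyMeasurable]

theorem integral_edgeLength (e : E) {f : X → ℝ} (hf : Continuous f) :
    ∫ᵛ x, f x ∂•Γ.edgeLength e = ∫ t in (0 : ℝ)..Γ.len e, f (Γ.param e t) := by
  have hm := (Γ.continuous_param e).measurable
  have hfin : IsFiniteMeasure (volume.restrict (Ioo 0 (Γ.len e))) := by
    constructor
    simp
  have h1 : ((volume.restrict (Ioo 0 (Γ.len e))).withDensityᵥ fun _ => (1 : ℝ)) =
      (volume.restrict (Ioo 0 (Γ.len e))).toSignedMeasure := by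
    refine VectorMeasure.ext fun A hA => ?_
    rw [withDensityᵥ_apply (integrable_const _) hA, Measure.toSignedMeasure_apply_measurable hA]
    simp
  have hint : Integrable (fun t => f (Γ.param e t)) (volume.restrict (Ioo 0 (Γ.len e))) :=
    ((hf.comp (Γ.continuous_param e)).continuousOn.integrableOn_compact
      (isCompact_Icc (a := 0) (b := Γ.len e))).mono_set Ioo_subset_Icc_self
  rw [edgeLength, edgeDensity, h1, VectorMeasure.integral_map hm
      hf.measurable.aestronglyMeasurable, SignedMeasure.integral_measure_toSignedMeasure,
    intervalIntegral.integral_of_le (Γ.len_pos e).le, integral_Ioc_eq_integral_Ioo]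
  rw [VectorMeasure.Integrable, Measure.variation_toSignedMeasure]
  exact hint

variable [Fintype E]

theorem integral_discrete_add_edgeLength (a : X → ℝ) (b : E → ℝ) {f : X → ℝ} (hf : Continuous f) :
    ∫ᵛ x, f x ∂•(∑ p ∈ Γ.vertices, a p • dirac p - ∑ e, b e • Γ.edgeLength e) =
      ∑ p : Γ.vertices, a p * f p - ∑ e, b e * ∫ t in (0 : ℝ)..Γ.len e, f (Γ.param e t) := by
  have := Γ.compactSpace
  rw [VectorMeasure.integral_sub_vectorMeasure (SignedMeasure.integrable_of_continuous _ hf)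
      (SignedMeasure.integrable_of_continuous _ hf),
    VectorMeasure.integral_finsetSum_vectorMeasure fun _ _ =>
      SignedMeasure.integrable_of_continuous _ hf,
    VectorMeasure.integral_finsetSum_vectorMeasure fun _ _ =>
      SignedMeasure.integrable_of_continuous _ hf]
  simp only [VectorMeasure.integral_smul_vectorMeasure, integral_dirac _ hf.measurable,
    Γ.integral_edgeLength _ hf, smul_eq_mul]
  rw [Finset.sum_coe_sort Γ.vertices fun p => a p * f p]

/-! ### The diagonal of the Green function -/

omit [MeasurableSpace X] [BorelSpace X] in
theorem localGreen_self (x : X) :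
    Γ.localGreen x x = ∑ e, Γ.coord e x * (Γ.len e - Γ.coord e x) / Γ.len e := by
  refine Finset.sum_congr rfl fun e _ => ?_
  have := (Γ.len_pos e).ne'
  rw [min_self]
  field_simp

omit [MeasurableSpace X] [BorelSpace X] in
theorem continuous_green_self : Continuous fun x => Γ.green x x := by
  classical
  have hw : Continuous Γ.weight := by
    refine continuous_pi fun p => ?_
    have : (fun x => Γ.weight x p) = Γ.interp (Pi.single p 1) := by
      funext x
      simp [interp]
    rw [this]
    exact Γ.continuous_interp _
  refine Continuous.add ?_ ?_
  · simp only [interp, dotProduct, Matrix.mulVec]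
    fun_prop
  · refine Γ.continuous_of_continuousOn_param fun e => ?_
    refine ContinuousOn.congr (f := fun t => t * (Γ.len e - t) / Γ.len e) (by fun_prop)
      fun t ht => ?_
    simp only [Γ.localGreen_param ht]
    have hL := (Γ.len_pos e).ne'
    by_cases h : t ∈ Ioo 0 (Γ.len e)
    · rw [Γ.coord_param h, min_self]
      field_simp
    · rw [Γ.coord_eq_zero_of_param_endpoint ht h, min_eq_right ht.1]
      have h' : t = 0 ∨ Γ.len e - t = 0 := by
        rcases eq_or_lt_of_le ht.1 with h0 | h0
        · exact Or.inl h0.symm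
        · refine Or.inr (sub_eq_zero.2 (le_antisymm (not_lt.1 fun h1 => h ⟨h0, h1⟩) ht.2))
      rcases h' with h' | h' <;> simp [h']

omit [MeasurableSpace X] [BorelSpace X] in
theorem integral_green_param (x : X) (e : E) :
    ∫ t in (0 : ℝ)..Γ.len e, Γ.green x (Γ.param e t) =
      Γ.len e / 2 * ((Γ.laplacianPinv *ᵥ Γ.weight x) (Γ.src e) +
        (Γ.laplacianPinv *ᵥ Γ.weight x) (Γ.tgt e)) +
      Γ.coord e x * (Γ.len e - Γ.coord e x) / 2 := by
  have hL := Γ.len_pos e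
  have hc := Γ.coord_mem e x
  set u := Γ.laplacianPinv *ᵥ Γ.weight x
  have h1 : ∫ t in (0 : ℝ)..Γ.len e, Γ.green x (Γ.param e t) =
      ∫ t in (0 : ℝ)..Γ.len e, (u (Γ.src e) + t * ((u (Γ.tgt e) - u (Γ.src e)) / Γ.len e -
        Γ.coord e x / Γ.len e) + min t (Γ.coord e x)) := by
    refine intervalIntegral.integral_congr fun t ht => ?_
    rw [uIcc_of_le hL.le] at ht
    rw [Γ.green_comm, green, Γ.interp_param _ ht, Γ.localGreen_param ht]
    ring
  rw [h1, intervalIntegral.integral_add, intervalIntegral.integral_add,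
    intervalIntegral.integral_const, intervalIntegral.integral_mul_const, integral_id,
    integral_min_const hc.1 hc.2.le]
  · rw [smul_eq_mul]
    field_simp
    ring
  all_goals exact Continuous.intervalIntegrable (by fun_prop) _ _

/-! ### The canonical measure -/

theorem voltageIntegral_self (μ : SignedMeasure X) (x : X) :
    Γ.voltageIntegral μ x x = Γ.green x x * μ univ + ∫ᵛ y, Γ.green y y ∂•μ -
      2 * ∫ᵛ y, Γ.green x y ∂•μ := by
  have := Γ.compactSpace
  have h1 : μ.Integrable fun _ => Γ.green x x := μ.integrable_of_continuous continuous_const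
  have h2 := μ.integrable_of_continuous Γ.continuous_green_self
  have h3 := μ.integrable_of_continuous (Γ.continuous_green_right x)
  have h4 := VectorMeasure.integral_smul (Γ.green x) μ (ContinuousLinearMap.lsmul ℝ ℝ) (2 : ℝ)
  simp only [Pi.smul_apply, smul_eq_mul] at h4
  simp only [voltageIntegral, voltage_self]
  rw [VectorMeasure.integral_fun_sub (h1.fun_add h2) (MeasureTheory.Integrable.const_mul h3 2),
    VectorMeasure.integral_fun_add h1 h2, VectorMeasure.integral_const, h4]
  simp

/-- When the total mass is 1, the term ∫ g(y, y) dμ(y) of j_μ(x, x) does not depend on x and can be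
absorbed into the constant. -/
theorem isCanonicalMeasure_iff (μ : SignedMeasure X) :
    Γ.IsCanonicalMeasure μ ↔
      μ univ = 1 ∧ ∃ c : ℝ, ∀ x, Γ.green x x - 2 * ∫ᵛ y, Γ.green x y ∂•μ = c := by
  refine and_congr_right fun h => ⟨?_, ?_⟩
  · rintro ⟨c, hc⟩
    refine ⟨c - ∫ᵛ y, Γ.green y y ∂•μ, fun x => ?_⟩
    rw [← hc x, voltageIntegral_self, h]
    ring
  · rintro ⟨c, hc⟩
    refine ⟨c + ∫ᵛ y, Γ.green y y ∂•μ, fun x => ?_⟩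
    rw [← hc x, voltageIntegral_self, h]
    ring

end MetrizedGraph

namespace MetrizedGraph

variable {X E : Type*} [TopologicalSpace X] (Γ : MetrizedGraph X E) [Fintype E]

/-! ### The formula gives a canonical measure -/

/-- This is where optimality enters: a parallel edge would add to the entry, and a loop would put it
on the diagonal. -/
theorem laplacianMatrix_src_tgt (hΓ : Γ.IsOptimal) (e : E) :
    Γ.laplacianMatrix (Γ.src e) (Γ.tgt e) = -(1 / Γ.len e) := by
  classical
  have hne := hΓ.no_loops e
  rw [laplacianMatrix, Matrix.sub_apply, Matrix.diagonal_apply_ne _ hne, zero_sub, adjMatrix,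
    Matrix.of_apply, if_neg hne]
  congr 1
  rw [Finset.sum_eq_single e]
  · intro e' he' hne'
    exact absurd (hΓ.no_multiple_edges e' e (Finset.mem_filter.1 he').2) hne'
  · simp

theorem sum_vertices_valence (u : Γ.vertices → ℝ) :
    ∑ p : Γ.vertices, (1 - (Γ.valence p : ℝ) / 2) * u p =
      ∑ p, u p - ∑ e, (u (Γ.src e) + u (Γ.tgt e)) / 2 := by
  classical
  simp only [valence_vertex, sub_mul, one_mul, Finset.sum_sub_distrib, Finset.sum_div,
    Finset.sum_mul]
  congr 1
  rw [Finset.sum_comm]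
  refine Finset.sum_congr rfl fun e _ => ?_
  simp only [add_div, add_mul, Finset.sum_add_distrib, ite_div, zero_div, ite_mul, zero_mul,
    Finset.sum_ite_eq, Finset.mem_univ, if_true]
  ring

/-- The values at the vertices of `g(x, x) - 2 ∫ g(x, y) dμ(y)`, for the canonical measure `μ`. -/
noncomputable def canonicalPotential (q : Γ.vertices) : ℝ :=
  Γ.laplacianPinv q q - 2 * (Γ.laplacianPinv *ᵥ fun _ => 1) q +
    ∑ e, Γ.edgeResistance e / Γ.len e *
      (Γ.laplacianPinv q (Γ.src e) + Γ.laplacianPinv q (Γ.tgt e))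

/-- With ρₑ = rₑ/Lₑ, the diagonal of L⁺ contributes 2(1 - 1/n) - ∑ ρₑ over the edges at q, the
vector L⁺1 contributes 0, and the last sum contributes ∑ ρₑ over the edges at q minus (2/n) ∑ ρₑ
over all edges. Foster's theorem makes the total 0. -/
theorem laplacianMatrix_mulVec_canonicalPotential :
    Γ.laplacianMatrix *ᵥ Γ.canonicalPotential = 0 := by
  classical
  set P := Γ.laplacianPinv with hP
  set ρ : E → ℝ := fun e => Γ.edgeResistance e / Γ.len e with hρ
  set n : ℝ := (Γ.vertices.card : ℝ) with hn
  have hn0 : n ≠ 0 := Γ.card_vertices_ne_zero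
  have hdecomp : Γ.canonicalPotential = (fun q => P q q) - (2 : ℝ) • (P *ᵥ fun _ => 1) +
      ∑ e, ρ e • ((P *ᵥ Pi.single (Γ.src e) 1) + P *ᵥ Pi.single (Γ.tgt e) 1) := by
    funext q
    simp [canonicalPotential, hρ, hP, mul_add]
  have hsingle : ∀ r q : Γ.vertices,
      (Γ.laplacianMatrix *ᵥ (P *ᵥ Pi.single r 1)) q = (if r = q then 1 else 0) - 1 / n := by
    intro r q
    rw [hP, laplacianMatrix_mulVec_laplacianPinv_mulVec, Pi.single_apply]
    simp [hn, eq_comm]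
  funext q
  have hone : (Γ.laplacianMatrix *ᵥ (P *ᵥ fun _ => 1)) q = 0 := by
    rw [hP, laplacianMatrix_mulVec_laplacianPinv_mulVec]
    simp [← hn, hn0]
  -- For an edge from q to r, (P q q - P r r) + (P q q - 2 P q r + P r r) = 2 (P q q - P q r).
  -- Summed with weights 1/Lₑ, this is twice the diagonal entry of L L⁺.
  have hdiag : (Γ.laplacianMatrix *ᵥ fun q => P q q) q +
      ∑ e, ρ e * ((if Γ.src e = q then 1 else 0) + if Γ.tgt e = q then 1 else 0) =
      2 * (1 - 1 / n) := by
    have h1 := Γ.laplacianMatrix_mul_laplacianPinv_apply q q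
    rw [if_pos rfl, ← hP, ← hn] at h1
    have h2 : (Γ.laplacianMatrix * P) q q = (Γ.laplacianMatrix *ᵥ fun r => P r q) q := rfl
    rw [← h1, h2, laplacianMatrix_mulVec_apply, laplacianMatrix_mulVec_apply,
      ← Finset.sum_add_distrib, Finset.mul_sum]
    refine Finset.sum_congr rfl fun e _ => ?_
    have hsymm : P (Γ.tgt e) (Γ.src e) = P (Γ.src e) (Γ.tgt e) :=
      Γ.isSymm_laplacianPinv.apply (Γ.src e) (Γ.tgt e)
    have key1 : Γ.src e = q → P (Γ.src e) q = P (Γ.src e) (Γ.src e) ∧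
        P (Γ.tgt e) q = P (Γ.src e) (Γ.tgt e) := by
      rintro rfl
      exact ⟨rfl, hsymm⟩
    have key2 : Γ.tgt e = q → P (Γ.src e) q = P (Γ.src e) (Γ.tgt e) ∧
        P (Γ.tgt e) q = P (Γ.tgt e) (Γ.tgt e) := by
      rintro rfl
      exact ⟨rfl, rfl⟩
    have hρe : ρ e = (P (Γ.src e) (Γ.src e) - 2 * P (Γ.src e) (Γ.tgt e) +
        P (Γ.tgt e) (Γ.tgt e)) / Γ.len e := rfl
    rw [hρe]
    by_cases hs : Γ.src e = q
    · by_cases ht : Γ.tgt e = q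
      · have e1 := (key1 hs).1.symm.trans (key2 ht).1
        have e2 := (key1 hs).2.symm.trans (key2 ht).2
        simp only [if_pos hs, if_pos ht, (key1 hs).1, (key1 hs).2]
        rw [e1, ← e2]
        ring
      · simp only [if_pos hs, if_neg ht, (key1 hs).1, (key1 hs).2]
        ring
    · by_cases ht : Γ.tgt e = q
      · simp only [if_neg hs, if_pos ht, (key2 ht).1, (key2 ht).2]
        ring
      · simp only [if_neg hs, if_neg ht]
        ring
  have hfoster : ∑ e, ρ e = n - 1 := Γ.sum_edgeResistance_div_len
  rw [hdecomp, Matrix.mulVec_add, Matrix.mulVec_sub, Matrix.mulVec_smul, Matrix.mulVec_sum]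
  simp only [Matrix.mulVec_smul, Matrix.mulVec_add, Pi.add_apply, Pi.sub_apply, Pi.smul_apply,
    Finset.sum_apply, smul_eq_mul, hone, hsingle, mul_zero, sub_zero, Pi.zero_apply]
  have hsplit : ∑ e, ρ e * ((if Γ.src e = q then 1 else 0) - 1 / n +
      ((if Γ.tgt e = q then 1 else 0) - 1 / n)) =
      ∑ e, ρ e * ((if Γ.src e = q then 1 else 0) + if Γ.tgt e = q then 1 else 0) -
        (∑ e, ρ e) * (2 / n) := by
    rw [Finset.sum_mul, ← Finset.sum_sub_distrib]
    refine Finset.sum_congr rfl fun e _ => ?_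
    ring
  rw [hsplit, hfoster, ← add_sub_assoc, hdiag]
  field_simp
  ring

theorem canonicalPotential_const (p q : Γ.vertices) :
    Γ.canonicalPotential p = Γ.canonicalPotential q :=
  Γ.const_of_laplacianMatrix_mulVec_eq_zero Γ.laplacianMatrix_mulVec_canonicalPotential p q

/-- The diagonal of `L⁺`, interpolated along the edges. -/
theorem interp_diag_laplacianPinv (x : X) :
    Γ.interp (fun q => Γ.laplacianPinv q q) x = Γ.interp (Γ.laplacianPinv *ᵥ Γ.weight x) x +
      ∑ e, Γ.edgeResistance e / Γ.len e * (Γ.coord e x * (Γ.len e - Γ.coord e x)) / Γ.len e := by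
  classical
  set P := Γ.laplacianPinv with hP
  have hcol : ∀ q, (P *ᵥ Γ.weight x) q = Γ.interp (fun r => P r q) x := by
    intro q
    rw [interp, Matrix.mulVec, dotProduct_comm]
    congr 1
    funext r
    exact Γ.isSymm_laplacianPinv.apply r q
  rcases Γ.cover x with hx | ⟨e, t, ht, rfl⟩
  · have h0 : ∀ e, Γ.edgeResistance e / Γ.len e *
        (Γ.coord e x * (Γ.len e - Γ.coord e x)) / Γ.len e = 0 := fun e => by
      simp [Γ.coord_vertex e hx]
    obtain ⟨p, rfl⟩ : ∃ q : Γ.vertices, (q : X) = x := ⟨⟨x, hx⟩, rfl⟩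
    rw [Finset.sum_congr rfl fun e _ => h0 e, Γ.interp_vertex, Γ.interp_vertex, hcol,
      Γ.interp_vertex]
    simp
  · have hL := (Γ.len_pos e).ne'
    have hsymm : P (Γ.tgt e) (Γ.src e) = P (Γ.src e) (Γ.tgt e) :=
      Γ.isSymm_laplacianPinv.apply (Γ.src e) (Γ.tgt e)
    rw [Finset.sum_eq_single e]
    -- With λ = t/L, linear minus quadratic interpolation is (1-λ)a + λc - ((1-λ)²a + 2λ(1-λ)b +
    -- λ²c) = λ(1-λ)(a - 2b + c), and the last factor is the resistance.
    · simp only [Γ.interp_param_interior _ ht, hcol, Γ.coord_param ht, edgeResistance, ← hP, hsymm]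
      field_simp
      ring
    · intro e' _ hne
      simp [Γ.coord_param_of_ne hne ht]
    · simp

variable [MeasurableSpace X] [BorelSpace X]

/-- The canonical measure, by the explicit formula. -/
noncomputable def canonicalMeasure : SignedMeasure X :=
  ∑ p ∈ Γ.vertices, (1 - (Γ.valence p : ℝ) / 2) • dirac p -
    ∑ e, (Γ.laplacianMatrix (Γ.src e) (Γ.tgt e) +
      Γ.laplacianMatrix (Γ.src e) (Γ.tgt e) ^ 2 * Γ.edgeResistance e) • Γ.edgeLength e

theorem integral_canonicalMeasure (hΓ : Γ.IsOptimal) {f : X → ℝ} (hf : Continuous f) :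
    ∫ᵛ x, f x ∂•Γ.canonicalMeasure =
      ∑ p : Γ.vertices, f p - ∑ e, (f (Γ.src e) + f (Γ.tgt e)) / 2 +
        ∑ e, (1 - Γ.edgeResistance e / Γ.len e) / Γ.len e *
          ∫ t in (0 : ℝ)..Γ.len e, f (Γ.param e t) := by
  rw [canonicalMeasure, Γ.integral_discrete_add_edgeLength (fun p => 1 - (Γ.valence p : ℝ) / 2) _ hf,
    Γ.sum_vertices_valence fun p => f p, sub_eq_add_neg, ← Finset.sum_neg_distrib]
  congr 1
  refine Finset.sum_congr rfl fun e _ => ?_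
  have := (Γ.len_pos e).ne'
  rw [Γ.laplacianMatrix_src_tgt hΓ]
  field_simp
  ring

/-- The atoms have total mass n - |E| and the edges |E| - ∑ rₑ/Lₑ; Foster's theorem leaves 1. -/
theorem canonicalMeasure_univ (hΓ : Γ.IsOptimal) : Γ.canonicalMeasure univ = 1 := by
  rw [← SignedMeasure.integral_one, Γ.integral_canonicalMeasure hΓ continuous_const]
  have h := Γ.sum_edgeResistance_div_len
  have h1 : ∀ e, (1 - Γ.edgeResistance e / Γ.len e) / Γ.len e *
      ∫ _t in (0 : ℝ)..Γ.len e, (1 : ℝ) = 1 - Γ.edgeResistance e / Γ.len e := by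
    intro e
    have := (Γ.len_pos e).ne'
    rw [intervalIntegral.integral_const, smul_eq_mul]
    field_simp
    ring
  simp only [h1, Finset.sum_sub_distrib, h]
  simp

theorem green_self_sub_integral_canonicalMeasure (hΓ : Γ.IsOptimal) (x : X) :
    Γ.green x x - 2 * ∫ᵛ y, Γ.green x y ∂•Γ.canonicalMeasure =
      Γ.interp Γ.canonicalPotential x := by
  classical
  set u := Γ.laplacianPinv *ᵥ Γ.weight x with hu
  have hvert : ∀ p : Γ.vertices, Γ.green x p = u p := by
    intro p
    rw [Γ.green_comm, green, Γ.localGreen_vertex p.2, add_zero, Γ.interp_vertex]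
  rw [Γ.integral_canonicalMeasure hΓ (Γ.continuous_green_right x)]
  simp only [hvert, integral_green_param, ← hu]
  have hpot : Γ.interp Γ.canonicalPotential x = Γ.interp (fun q => Γ.laplacianPinv q q) x -
      2 * ∑ p, u p +
        ∑ e, Γ.edgeResistance e / Γ.len e * (u (Γ.src e) + u (Γ.tgt e)) := by
    have hcol : ∀ q, Γ.weight x ⬝ᵥ (fun r => Γ.laplacianPinv r q) = u q := by
      intro q
      rw [hu, Matrix.mulVec, dotProduct_comm]
      congr 1
      funext r
      exact Γ.isSymm_laplacianPinv.apply q r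
    have hone : Γ.weight x ⬝ᵥ (Γ.laplacianPinv *ᵥ fun _ => 1) = ∑ p, u p := by
      rw [Matrix.dotProduct_mulVec, ← Matrix.mulVec_transpose, Γ.isSymm_laplacianPinv]
      simp [dotProduct, hu]
    have hdecomp : Γ.canonicalPotential = (fun q => Γ.laplacianPinv q q) -
        (2 : ℝ) • (Γ.laplacianPinv *ᵥ fun _ => 1) +
        ∑ e, (Γ.edgeResistance e / Γ.len e) • ((fun r => Γ.laplacianPinv r (Γ.src e)) +
          fun r => Γ.laplacianPinv r (Γ.tgt e)) := by
      funext q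
      simp [canonicalPotential, mul_add]
    rw [interp, interp, hdecomp, dotProduct_add, dotProduct_sub, dotProduct_smul, hone,
      dotProduct_sum]
    simp only [dotProduct_smul, dotProduct_add, hcol, smul_eq_mul]
  rw [hpot, interp_diag_laplacianPinv, green, Γ.localGreen_self, ← hu]
  -- The edge term of g(x, x) and the half-valence atoms cancel against the arc length part with
  -- density 1/Lₑ. The remaining resistance terms are those of the interpolated diagonal of L⁺ and
  -- of the potential.
  have hterm : ∀ e, Γ.coord e x * (Γ.len e - Γ.coord e x) / Γ.len e -
      2 * (-((u (Γ.src e) + u (Γ.tgt e)) / 2) +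
        (1 - Γ.edgeResistance e / Γ.len e) / Γ.len e * (Γ.len e / 2 *
          (u (Γ.src e) + u (Γ.tgt e)) + Γ.coord e x * (Γ.len e - Γ.coord e x) / 2)) =
      Γ.edgeResistance e / Γ.len e * (Γ.coord e x * (Γ.len e - Γ.coord e x)) / Γ.len e +
        Γ.edgeResistance e / Γ.len e * (u (Γ.src e) + u (Γ.tgt e)) := by
    intro e
    have := (Γ.len_pos e).ne'
    field_simp
    ring
  have hsum := Finset.sum_congr rfl fun e (_ : e ∈ Finset.univ) => hterm e
  simp only [Finset.sum_sub_distrib, Finset.sum_add_distrib, ← Finset.mul_sum,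
    Finset.sum_neg_distrib] at hsum ⊢
  linarith

theorem isCanonicalMeasure_canonicalMeasure (hΓ : Γ.IsOptimal) :
    Γ.IsCanonicalMeasure Γ.canonicalMeasure := by
  rw [isCanonicalMeasure_iff]
  obtain ⟨p, hp⟩ := Γ.vertices_nonempty
  refine ⟨Γ.canonicalMeasure_univ hΓ, Γ.canonicalPotential ⟨p, hp⟩, fun x => ?_⟩
  have h : Γ.canonicalPotential = fun _ => Γ.canonicalPotential ⟨p, hp⟩ :=
    funext fun q => Γ.canonicalPotential_const q _
  rw [Γ.green_self_sub_integral_canonicalMeasure hΓ, interp, h]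
  simp only [dotProduct]
  rw [← Finset.sum_mul, Γ.sum_weight, one_mul]

end MetrizedGraph

namespace MetrizedGraph

variable {X E : Type*} [TopologicalSpace X] (Γ : MetrizedGraph X E) [MeasurableSpace X]
  [BorelSpace X]

/-! ### Uniqueness of the canonical measure -/

omit [MeasurableSpace X] [BorelSpace X] in
theorem preimage_coord_Ioi {e : E} {a : ℝ} (ha : 0 ≤ a) :
    Γ.coord e ⁻¹' Ioi a = Γ.param e '' Ioo a (Γ.len e) := by
  ext x
  constructor
  · intro h
    have h' : a < Γ.coord e x := h
    exact ⟨Γ.coord e x, ⟨h', (Γ.coord_mem e x).2⟩, Γ.param_coord (ha.trans_lt h')⟩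
  · rintro ⟨t, ht, rfl⟩
    rw [mem_preimage, Γ.coord_param ⟨ha.trans_lt ht.1, ht.2⟩]
    exact ht.1

/-- The coordinate is not continuous, as it drops to 0 at the far end, but its superlevel sets are
injective continuous images of intervals, hence Borel. -/
theorem measurable_coord (e : E) : Measurable (Γ.coord e) := by
  refine measurable_of_Ioi fun a => ?_
  rcases le_or_gt 0 a with ha | ha
  · rw [Γ.preimage_coord_Ioi ha]
    exact Γ.measurableSet_image_Ioo (Ioo_subset_Ioo_left ha)
  · have : Γ.coord e ⁻¹' Ioi a = univ :=
      eq_univ_of_forall fun x => ha.trans_le (Γ.coord_mem e x).1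
    rw [this]
    exact MeasurableSet.univ

/-- If the integrals of `min t s`, where `s` is the coordinate along an edge, are a linear function
of `t`, then the tails of the measure along the edge have constant mass. -/
theorem measure_coord_gt_eq {ν : SignedMeasure X} {e : E} {m : ℝ}
    (h : ∀ t ∈ Ico 0 (Γ.len e), ∫ᵛ x, min t (Γ.coord e x) ∂•ν = t * m) {t : ℝ}
    (ht : t ∈ Ico 0 (Γ.len e)) : ν (Γ.coord e ⁻¹' Ioi t) = m := by
  have hs := Γ.measurable_coord e
  rw [← SignedMeasure.integral_indicator_one ν (hs measurableSet_Ioi)]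
  set δ : ℕ → ℝ := fun n => 1 / ((n : ℝ) + 1) with hδ
  have hδpos : ∀ n, 0 < δ n := fun n => Nat.one_div_pos_of_nat
  have hδlim : Tendsto δ atTop (𝓝 0) := tendsto_one_div_add_atTop_nhds_zero_nat
  -- Difference quotients in t of min t s are bounded by 1 and converge to the indicator of s > t,
  -- so dominated convergence differentiates the hypothesis.
  set F : ℕ → X → ℝ := fun n x =>
    (δ n)⁻¹ * (min (t + δ n) (Γ.coord e x) - min t (Γ.coord e x)) with hF
  have hFbound : ∀ n x, ‖F n x‖ ≤ 1 := by
    intro n x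
    have h1 : 0 ≤ min (t + δ n) (Γ.coord e x) - min t (Γ.coord e x) :=
      sub_nonneg.2 (min_le_min_right _ (by linarith [hδpos n]))
    have h2 : min (t + δ n) (Γ.coord e x) - min t (Γ.coord e x) ≤ δ n := by
      rcases le_total t (Γ.coord e x) with hc | hc
      · rw [min_eq_left hc]
        linarith [min_le_left (t + δ n) (Γ.coord e x)]
      · rw [min_eq_right hc]
        linarith [min_le_right (t + δ n) (Γ.coord e x), hδpos n]
    rw [Real.norm_eq_abs, abs_of_nonneg (mul_nonneg (inv_nonneg.2 (hδpos n).le) h1),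
      inv_mul_le_iff₀ (hδpos n), mul_one]
    exact h2
  have hmin : ∀ a : ℝ, Measurable fun x => min a (Γ.coord e x) := fun a =>
    measurable_const.min hs
  have hlim : Tendsto (fun n => ∫ᵛ x, F n x ∂•ν) atTop
      (𝓝 (∫ᵛ x, (Γ.coord e ⁻¹' Ioi t).indicator (fun _ => (1 : ℝ)) x ∂•ν)) := by
    refine VectorMeasure.tendsto_integral_of_dominated_convergence (fun _ => 1)
      (fun n => ?_) (integrable_const _) (fun n => Eventually.of_forall (hFbound n))
      (Eventually.of_forall fun x => ?_)
    · exact (((hmin _).sub (hmin _)).const_mul _).aestronglyMeasurable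
    · by_cases hx : t < Γ.coord e x
      · rw [indicator_of_mem (show x ∈ Γ.coord e ⁻¹' Ioi t from hx)]
        refine tendsto_const_nhds.congr' ?_
        have h1 : ∀ᶠ n in atTop, δ n < Γ.coord e x - t :=
          hδlim.eventually (eventually_lt_nhds (sub_pos.2 hx))
        filter_upwards [h1] with n hn
        rw [hF]
        simp only
        rw [min_eq_left (by linarith), min_eq_left hx.le, add_sub_cancel_left,
          inv_mul_cancel₀ (hδpos n).ne']
      · rw [indicator_of_notMem (show x ∉ Γ.coord e ⁻¹' Ioi t from hx)]
        refine tendsto_const_nhds.congr fun n => ?_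
        have hx' := not_lt.1 hx
        rw [hF]
        simp only
        rw [min_eq_right hx', min_eq_right (by linarith [hδpos n]), sub_self, mul_zero]
  have hconst : ∀ᶠ n in atTop, ∫ᵛ x, F n x ∂•ν = m := by
    have h1 : ∀ᶠ n in atTop, δ n < Γ.len e - t :=
      hδlim.eventually (eventually_lt_nhds (sub_pos.2 ht.2))
    filter_upwards [h1] with n hn
    have hint : ∀ a ∈ Ico 0 (Γ.len e), ν.Integrable fun x => min a (Γ.coord e x) := by
      intro a ha
      refine ν.integrable_of_bound (hmin a) (C := a) fun x => ?_
      rw [abs_of_nonneg (le_min ha.1 (Γ.coord_mem e x).1)]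
      exact min_le_left _ _
    have ht' : t + δ n ∈ Ico 0 (Γ.len e) := ⟨by linarith [hδpos n, ht.1], by linarith⟩
    have h2 := VectorMeasure.integral_fun_smul ν (ContinuousLinearMap.lsmul ℝ ℝ) (δ n)⁻¹
      fun x => min (t + δ n) (Γ.coord e x) - min t (Γ.coord e x)
    simp only [smul_eq_mul] at h2
    rw [hF]
    simp only
    rw [h2, VectorMeasure.integral_fun_sub (hint _ ht') (hint _ ht), h _ ht', h _ ht]
    have := (hδpos n).ne'
    field_simp
    ring
  exact tendsto_nhds_unique hlim (tendsto_const_nhds.congr' (hconst.mono fun n hn => hn.symm))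

theorem measure_coord_gt_eq_zero {ν : SignedMeasure X} {e : E} {m : ℝ}
    (h : ∀ t ∈ Ico 0 (Γ.len e), ∫ᵛ x, min t (Γ.coord e x) ∂•ν = t * m) {t : ℝ}
    (ht : 0 ≤ t) : ν (Γ.coord e ⁻¹' Ioi t) = 0 := by
  have hs := Γ.measurable_coord e
  have hL := Γ.len_pos e
  have hm : m = 0 := by
    -- All tails beyond t < `len e` have mass m. Along levels increasing to `len e` they shrink to
    -- the empty set, since `coord` stays below `len e`; so m = 0.
    set a : ℕ → ℝ := fun n => Γ.len e - Γ.len e * (1 / ((n : ℝ) + 1)) with ha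
    have hδ : ∀ n : ℕ, 0 < 1 / ((n : ℝ) + 1) ∧ 1 / ((n : ℝ) + 1) ≤ 1 := fun n =>
      ⟨Nat.one_div_pos_of_nat, by
        rw [div_le_one (by positivity)]; linarith [Nat.cast_nonneg (α := ℝ) n]⟩
    have haI : ∀ n, a n ∈ Ico 0 (Γ.len e) := fun n =>
      ⟨sub_nonneg.2 (mul_le_of_le_one_right hL.le (hδ n).2),
        sub_lt_self _ (mul_pos hL (hδ n).1)⟩
    have hanti : Antitone fun n => Γ.coord e ⁻¹' Ioi (a n) := by
      intro i j hij
      refine preimage_mono (Ioi_subset_Ioi ?_)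
      rw [ha]
      have := Nat.one_div_le_one_div (α := ℝ) hij
      exact sub_le_sub_left (mul_le_mul_of_nonneg_left this hL.le) _
    have hlim := VectorMeasure.tendsto_vectorMeasure_iInter_atTop_nat (v := ν) hanti
      fun n => hs measurableSet_Ioi
    have hempty : ⋂ n, Γ.coord e ⁻¹' Ioi (a n) = ∅ := by
      rw [eq_empty_iff_forall_notMem]
      intro x hx
      have hx' : ∀ n, a n ≤ Γ.coord e x := fun n => le_of_lt (mem_iInter.1 hx n)
      have halim : Tendsto a atTop (𝓝 (Γ.len e)) := by
        have := (tendsto_one_div_add_atTop_nhds_zero_nat (𝕜 := ℝ)).const_mul (Γ.len e)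
        simpa [ha] using this.const_sub (Γ.len e)
      exact absurd (le_of_tendsto' halim hx') (not_le.2 (Γ.coord_mem e x).2)
    rw [hempty, VectorMeasure.empty] at hlim
    simp only [fun n => Γ.measure_coord_gt_eq h (haI n)] at hlim
    exact tendsto_nhds_unique tendsto_const_nhds hlim
  rcases lt_or_ge t (Γ.len e) with ht' | ht'
  · rw [Γ.measure_coord_gt_eq h ⟨ht, ht'⟩, hm]
  · have : Γ.coord e ⁻¹' Ioi t = ∅ := by
      rw [eq_empty_iff_forall_notMem]
      intro x hx
      exact absurd (ht'.trans_lt hx) (not_lt.2 (Γ.coord_mem e x).2.le)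
    rw [this, VectorMeasure.empty]

theorem measure_inter_edge_eq_zero {ν : SignedMeasure X} {e : E}
    (h : ∀ t, 0 ≤ t → ν (Γ.coord e ⁻¹' Ioi t) = 0) {A : Set X} (hA : MeasurableSet A) :
    ν (A ∩ Γ.coord e ⁻¹' Ioi 0) = 0 := by
  have hs := Γ.measurable_coord e
  have hs0 : MeasurableSet (Γ.coord e ⁻¹' Ioi 0) := hs measurableSet_Ioi
  -- Restricting to positive coordinates discards the points off the open edge, all of which have
  -- coordinate 0. The open rays then form a generating π-system on which the pushforward vanishes.
  have hmap : (ν.restrict (Γ.coord e ⁻¹' Ioi 0)).map (Γ.coord e) = 0 := by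
    refine VectorMeasure.ext_of_generateFrom (range Ioi) ?_
      (BorelSpace.measurable_eq.trans (borel_eq_generateFrom_Ioi ℝ)) isPiSystem_Ioi ?_
    · rintro _ ⟨a, rfl⟩
      rw [VectorMeasure.map_apply _ hs measurableSet_Ioi,
        VectorMeasure.restrict_apply _ hs0 (hs measurableSet_Ioi), ← preimage_inter,
        Ioi_inter_Ioi, h _ le_sup_right, _root_.zero_apply]
    · rw [VectorMeasure.map_apply _ hs MeasurableSet.univ, preimage_univ,
        VectorMeasure.restrict_apply _ hs0 MeasurableSet.univ, univ_inter, h 0 le_rfl,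
        _root_.zero_apply]
  have hB : MeasurableSet (Γ.param e ⁻¹' A) := (Γ.continuous_param e).measurable hA
  have heq : A ∩ Γ.coord e ⁻¹' Ioi 0 =
      Γ.coord e ⁻¹' (Γ.param e ⁻¹' A) ∩ Γ.coord e ⁻¹' Ioi 0 := by
    ext x
    simp only [mem_inter_iff, mem_preimage]
    refine and_congr_left fun hx => ?_
    rw [Γ.param_coord hx]
  have h1 := congrArg (fun v : SignedMeasure ℝ => v (Γ.param e ⁻¹' A)) hmap
  beta_reduce at h1
  rw [VectorMeasure.map_apply _ hs hB, VectorMeasure.restrict_apply _ hs0 (hs hB)] at h1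
  rw [heq, h1, _root_.zero_apply]

variable [Fintype E]

theorem eq_sum_dirac_of_measure_inter_edge_eq_zero {ν : SignedMeasure X}
    (h : ∀ e, ∀ A, MeasurableSet A → ν (A ∩ Γ.coord e ⁻¹' Ioi 0) = 0) :
    ν = ∑ p ∈ Γ.vertices, ν {p} • dirac p := by
  classical
  have := Γ.t2
  refine VectorMeasure.ext fun A hA => ?_
  have hV : MeasurableSet (Γ.vertices : Set X) := Γ.vertices.finite_toSet.measurableSet
  have hcompl : A \ Γ.vertices = ⋃ e, A ∩ Γ.coord e ⁻¹' Ioi 0 := by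
    ext x
    simp only [Set.mem_sdiff, Finset.mem_coe, mem_iUnion, mem_inter_iff, exists_and_left]
    refine and_congr_right fun _ => ⟨fun hx => ?_, ?_⟩
    · rcases Γ.cover x with hv | ⟨e, t, ht, rfl⟩
      · exact absurd hv hx
      · refine ⟨e, ?_⟩
        rw [mem_preimage, Γ.coord_param ht]
        exact ht.1
    · rintro ⟨e, he⟩ hv
      rw [mem_preimage, Γ.coord_vertex e hv] at he
      exact lt_irrefl (0 : ℝ) he
  have hdisj : Pairwise (Function.onFun Disjoint fun e => A ∩ Γ.coord e ⁻¹' Ioi 0) := by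
    intro e e' hne
    refine Set.disjoint_left.2 ?_
    rintro x ⟨_, hx⟩ ⟨_, hx'⟩
    have hI : Γ.coord e' x ∈ Ioo 0 (Γ.len e') := ⟨hx', (Γ.coord_mem e' x).2⟩
    have h0 := Γ.coord_param_of_ne hne hI
    rw [Γ.param_coord hx'] at h0
    rw [mem_preimage, h0] at hx
    exact lt_irrefl (0 : ℝ) hx
  have h1 : ν (A \ Γ.vertices) = 0 := by
    rw [hcompl, VectorMeasure.of_disjoint_iUnion
      (fun e => hA.inter (Γ.measurable_coord e measurableSet_Ioi)) hdisj]
    simp only [fun e => h e A hA, tsum_zero]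
  have h2 : ν (A ∩ Γ.vertices) = ∑ p ∈ Γ.vertices, ν (A ∩ {p}) := by
    rw [← VectorMeasure.of_biUnion_finset]
    · congr 1
      ext x
      simp
    · intro p _ q _ hpq
      exact (disjoint_singleton.2 hpq).mono inter_subset_right inter_subset_right
    · exact fun p _ => hA.inter (measurableSet_singleton p)
  have h3 := VectorMeasure.of_union (v := ν)
    (disjoint_sdiff_self_left.mono_right inter_subset_right : Disjoint (A \ Γ.vertices)
      (A ∩ (Γ.vertices : Set X))) (hA.diff hV) (hA.inter hV)
  rw [sdiff_union_inter, h1, zero_add, h2] at h3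
  rw [h3, sum_apply]
  refine Finset.sum_congr rfl fun p _ => ?_
  rw [_root_.smul_apply, dirac_apply p hA, smul_eq_mul]
  split_ifs with hp
  · rw [inter_eq_right.2 (singleton_subset_iff.2 hp), mul_one]
  · rw [inter_singleton_eq_empty.2 hp, VectorMeasure.empty, mul_zero]

/-- Nondegeneracy of the Green kernel on measures of mass 0. Second differences along an edge remove
the interior part; for the vertex masses n, constancy of L⁺ n gives 0 = L L⁺ n = n. -/
theorem eq_zero_of_integral_green_const {ν : SignedMeasure X} (h0 : ν univ = 0) {c : ℝ}
    (hc : ∀ x, ∫ᵛ y, Γ.green x y ∂•ν = c) : ν = 0 := by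
  classical
  have hcomp := Γ.compactSpace
  have := Γ.t2
  have hedge : ∀ e, ∀ A, MeasurableSet A → ν (A ∩ Γ.coord e ⁻¹' Ioi 0) = 0 := by
    intro e A hA
    have hL := Γ.len_pos e
    have hs := Γ.measurable_coord e
    have hsint : ν.Integrable (Γ.coord e) := ν.integrable_of_bound hs (C := Γ.len e) fun x => by
      rw [abs_of_nonneg (Γ.coord_mem e x).1]
      exact (Γ.coord_mem e x).2.le
    refine Γ.measure_inter_edge_eq_zero (fun t ht => Γ.measure_coord_gt_eq_zero
      (m := (∫ᵛ x, Γ.coord e x ∂•ν) / Γ.len e) (fun t ht => ?_) ht) hA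
    have hint : ∀ x, ν.Integrable fun y => Γ.green x y := fun x =>
      ν.integrable_of_continuous (Γ.continuous_green_right x)
    have hsmul : ∀ (a : ℝ) (f : X → ℝ), ∫ᵛ y, a * f y ∂•ν = a * ∫ᵛ y, f y ∂•ν := fun a f =>
      VectorMeasure.integral_fun_smul ν (ContinuousLinearMap.lsmul ℝ ℝ) a f
    -- Subtracting the affine interpolation of the end point values leaves only the Dirichlet kernel
    -- of e. The coefficients 1, -(1 - t/L), -t/L sum to 0, so the constant c drops out and the
    -- integral is linear in t.
    have hpt : ∀ y, min t (Γ.coord e y) = Γ.green (Γ.param e t) y -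
        (1 - t / Γ.len e) * Γ.green (Γ.src e) y - t / Γ.len e * Γ.green (Γ.tgt e) y +
          t / Γ.len e * Γ.coord e y := by
      intro y
      simp only [green, Γ.localGreen_vertex (Γ.src e).2, Γ.localGreen_vertex (Γ.tgt e).2,
        Γ.interp_vertex, Γ.interp_param _ (Ico_subset_Icc_self ht),
        Γ.localGreen_param (Ico_subset_Icc_self ht)]
      ring
    have i1 := hint (Γ.param e t)
    have i2 : ν.Integrable fun y => (1 - t / Γ.len e) * Γ.green (Γ.src e) y :=
      MeasureTheory.Integrable.const_mul (hint _) _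
    have i3 : ν.Integrable fun y => t / Γ.len e * Γ.green (Γ.tgt e) y :=
      MeasureTheory.Integrable.const_mul (hint _) _
    have i4 : ν.Integrable fun y => t / Γ.len e * Γ.coord e y :=
      MeasureTheory.Integrable.const_mul hsint _
    simp only [hpt]
    rw [VectorMeasure.integral_fun_add ((i1.fun_sub i2).fun_sub i3) i4,
      VectorMeasure.integral_fun_sub (i1.fun_sub i2) i3, VectorMeasure.integral_fun_sub i1 i2,
      hsmul, hsmul, hsmul, hc, hc, hc]
    ring
  have hν := Γ.eq_sum_dirac_of_measure_inter_edge_eq_zero hedge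
  set n : Γ.vertices → ℝ := fun p => ν {(p : X)} with hn
  have hint : ∀ f : X → ℝ, Continuous f → ∫ᵛ y, f y ∂•ν = ∑ p : Γ.vertices, n p * f p := by
    intro f hf
    have h1 := Γ.integral_discrete_add_edgeLength (fun p => ν {p}) (fun _ => 0) hf
    simpa [← hν] using h1
  have hsum : ∑ p, n p = 0 := by
    rw [← h0, ← SignedMeasure.integral_one, hint _ continuous_const]
    simp
  have hPn : ∀ q, (Γ.laplacianPinv *ᵥ n) q = c := by
    intro q
    rw [← hc q, hint _ (Γ.continuous_green_right q), Matrix.mulVec, dotProduct]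
    refine Finset.sum_congr rfl fun p _ => ?_
    have hw : Γ.weight p = Pi.single p 1 := by
      funext r
      have := Γ.interp_vertex (Pi.single r 1) p
      rw [interp, dotProduct_single, mul_one] at this
      rw [this, Pi.single_comm]
    rw [green, Γ.localGreen_vertex q.2, add_zero, Γ.interp_vertex, hw]
    simp [mul_comm]
  have hn0 : n = 0 := by
    funext p
    have h1 := Γ.laplacianMatrix_mulVec_laplacianPinv_mulVec n p
    have h2 : Γ.laplacianPinv *ᵥ n = c • fun _ => 1 := by
      funext q
      simp [hPn]
    rw [h2, Matrix.mulVec_smul, Γ.laplacianMatrix_mulVec_one, hsum] at h1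
    simpa using h1.symm
  rw [hν]
  refine Finset.sum_eq_zero fun p hp => ?_
  have : ν {p} = 0 := congrFun hn0 ⟨p, hp⟩
  rw [this, zero_smul]

theorem IsCanonicalMeasure.unique {Γ : MetrizedGraph X E} {μ μ' : SignedMeasure X}
    (h : Γ.IsCanonicalMeasure μ) (h' : Γ.IsCanonicalMeasure μ') : μ = μ' := by
  have := Γ.compactSpace
  rw [isCanonicalMeasure_iff] at h h'
  obtain ⟨h1, c, hc⟩ := h
  obtain ⟨h1', c', hc'⟩ := h'
  rw [← sub_eq_zero]
  refine Γ.eq_zero_of_integral_green_const (c := (c' - c) / 2) ?_ fun x => ?_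
  · rw [_root_.sub_apply, h1, h1', sub_self]
  · have hint : ∀ m : SignedMeasure X, m.Integrable fun y => Γ.green x y := fun m =>
      m.integrable_of_continuous (Γ.continuous_green_right x)
    rw [VectorMeasure.integral_sub_vectorMeasure (hint μ) (hint μ')]
    have e1 := hc x
    have e2 := hc' x
    linarith

end MetrizedGraph

theorem mainTheorem4 {X E : Type*} [TopologicalSpace X] [MeasurableSpace X] [BorelSpace X]
    [Fintype E] (Γ : MetrizedGraph X E) (hΓ : Γ.IsOptimal) (μ : SignedMeasure X) :
    Γ.IsCanonicalMeasure μ ↔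
      μ = ∑ p ∈ Γ.vertices, (1 - (Γ.valence p : ℝ) / 2) • MetrizedGraph.dirac p -
        ∑ e, (Γ.laplacianMatrix (Γ.src e) (Γ.tgt e) +
          Γ.laplacianMatrix (Γ.src e) (Γ.tgt e) ^ 2 *
            (Γ.laplacianPinv (Γ.src e) (Γ.src e) - 2 * Γ.laplacianPinv (Γ.src e) (Γ.tgt e) +
              Γ.laplacianPinv (Γ.tgt e) (Γ.tgt e))) • Γ.edgeLength e := by
  have h := Γ.isCanonicalMeasure_canonicalMeasure hΓ
  refine ⟨fun hμ => hμ.unique h, ?_⟩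
  rintro rfl
  exact h
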